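/- For an $N\times N$ symmetric matrix $J_N$ with zero diagonal and $\beta\ge 0$, the Ising model is the probability distribution on $\{-1,1\}^N$ given by $$\mathbb P_\beta(\sigma=\tau)=2^{-N}\exp\Big\{\tfrac12\beta H_N(\tau)-F_N(\beta)\Big\},\qquad H_N(\tau)=\tau'J_N\tau,\qquad F_N(\beta)=\log\Big(2^{-N}\sum_{\tau\in\{-1,1\}^N}e^{\frac12\beta H_N(\tau)}\Big).$$ The maximum pseudolikelihood estimator (MPLE) $\hat\beta_N=\hat\beta_N(\sigma)\in[0,\infty]$ is the (least) maximizer over $\beta\in[0,\infty)$ of the pseudolikelihood $\prod_{i=1}^N f_i(\beta,\sigma)$, where $f_i(\beta,\sigma)$ is the conditional probability under $\mathbb P_\beta$ of the value $\sigma_i$ given $(\sigma_j)_{j\ne i}$; if there is no maximizer, in which case the pseudolikelihood is strictly increasing on $[0,\infty)$, then $\hat\beta_N=\infty$. Fix $\beta_0>0$, let $p(N)\in[0,1]$ with $\frac{\log N}{N}\ll p(N)\le 1$, that is, $\frac{\log N}{N}=o(p(N))$ as $N\to\infty$, and let $G_N\sim G(N,p(N))$ be Erdős–Rényi random graphs with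 adjacency matrices $A(G_N)$. Consider the Ising model with $J_N=\frac1{Np(N)}A(G_N)$, that is, with sufficient statistic $H_N(\tau)=\frac{1}{Np(N)}\tau'A(G_N)\tau$. Call $\{\hat\beta_N\}$ $a_N$-consistent for $\beta_0$ if, conditionally on the graphs, $a_N|\hat\beta_N-\beta_0|=O_P(1)$ with high probability: for every $\varepsilon>0$ there is $K<\infty$ such that, with probability tending to $1$ over $G_N$ as $N\to\infty$, $$\mathbb P_{\beta_0}\big(a_N|\hat\beta_N-\beta_0|>K\,\big|\,G_N\big)\le\varepsilon .$$ (a) If $0<\beta_0<1$, then $\{\hat\beta_N\}$ is $\sqrt{1/p(N)}$-consistent for $\beta_0$. (b) If $\beta_0>1$, then $\{\hat\beta_N\}$ is $\sqrt N$-consistent for $\beta_0$. -/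

import Mathlib

open Filter Topology Asymptotics MeasureTheory

noncomputable section

namespace Ising

/-- Spin configurations `τ ∈ {-1, 1}^N`. -/
abbrev Config (N : ℕ) : Type := Fin N → ℤˣ

/-- The spin `τ_i` as a real number. -/
def spin {N : ℕ} (τ : Config N) (i : Fin N) : ℝ := ((τ i : ℤ) : ℝ)

/-- The sufficient statistic `H_N(τ) = τ' J τ`. -/
def hamiltonian {N : ℕ} (J : Matrix (Fin N) (Fin N) ℝ) (τ : Config N) : ℝ :=
  ∑ i, ∑ j, J i j * spin τ i * spin τ j

/-- The log-partition function `F_N(β) = log (2^{-N} ∑_τ exp (β H_N(τ) / 2))`. -/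
def logPartition {N : ℕ} (J : Matrix (Fin N) (Fin N) ℝ) (β : ℝ) : ℝ :=
  Real.log ((1 / 2 ^ N) * ∑ τ : Config N, Real.exp (1 / 2 * β * hamiltonian J τ))

/-- The probability mass function `P_β(σ = τ)` of the Ising model. -/
def pmf {N : ℕ} (J : Matrix (Fin N) (Fin N) ℝ) (β : ℝ) (τ : Config N) : ℝ :=
  (1 / 2 ^ N) * Real.exp (1 / 2 * β * hamiltonian J τ - logPartition J β)

/-- The probability `P_β(σ ∈ E)` of an event in the Ising model. -/
def prob {N : ℕ} (J : Matrix (Fin N) (Fin N) ℝ) (β : ℝ) (E : Set (Config N)) : ℝ :=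
  ∑ τ : Config N, E.indicator (pmf J β) τ

/-- The conditional density `f_i(β, τ)`: the probability that `σ_i = τ_i` given that
`σ_j = τ_j` for all `j ≠ i`. -/
def condDensity {N : ℕ} (J : Matrix (Fin N) (Fin N) ℝ) (β : ℝ) (τ : Config N) (i : Fin N) : ℝ :=
  pmf J β τ / ∑ s : ℤˣ, pmf J β (Function.update τ i s)

/-- The pseudolikelihood `∏ i, f_i(β, τ)`. -/
def pseudoLikelihood {N : ℕ} (J : Matrix (Fin N) (Fin N) ℝ) (β : ℝ) (τ : Config N) : ℝ :=
  ∏ i, condDensity J β τ i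

/-- The maximum pseudolikelihood estimator: the (least) maximizer of the pseudolikelihood over the
parameter space `[0, ∞)`. If there is no maximizer, the pseudolikelihood is strictly
increasing on `[0, ∞)` and the value is `sInf ∅ = ∞`. -/
def mple {N : ℕ} (J : Matrix (Fin N) (Fin N) ℝ) (τ : Config N) : EReal :=
  sInf {b : EReal | ∃ x : ℝ, b = (x : EReal) ∧ 0 ≤ x ∧
    IsMaxOn (fun β : ℝ => pseudoLikelihood J β τ) (Set.Ici 0) x}

/-- The probability `P_{β₀}(a |β̂ - β₀| > K)`, where `β̂` is the MPLE. -/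
def deviationProb {N : ℕ} (J : Matrix (Fin N) (Fin N) ℝ) (β₀ a K : ℝ) : ℝ :=
  prob J β₀ {τ | ENNReal.ofReal K < ENNReal.ofReal a * (mple J τ - (β₀ : EReal)).abs}

open Classical in
/-- The matrix `J = A(G) / (N p)`, where `A(G)` is the adjacency matrix of the graph `G`. -/
def graphInteraction {N : ℕ} (G : SimpleGraph (Fin N)) (p : ℝ) : Matrix (Fin N) (Fin N) ℝ :=
  (1 / ((N : ℝ) * p)) • G.adjMatrix ℝ

/-- In the Ising model on `G_N ∼ G(N, p(N))` with `J_N = A(G_N) / (N p(N))`, the sequence of MPLEs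
is `a_N`-consistent at `β₀`, given the graphs: `a_N |β̂_N - β₀|` is bounded in probability under
the law of the spins given `G_N`, for `G_N` outside an event of vanishing probability. -/
def IsConsistentErdosRenyi (p : ℕ → unitInterval) (β₀ : ℝ) (a : ℕ → ℝ) : Prop :=
  ∀ ε : ℝ, 0 < ε → ∃ K : ℝ,
    Tendsto (fun N : ℕ => SimpleGraph.binomialRandom (Fin N) (p N)
      {G | deviationProb (graphInteraction G (p N : ℝ)) β₀ (a N) K ≤ ε}) atTop (𝓝 1)

end Ising

end

/-! The log-pseudolikelihood is concave in `β`; its derivative is the score `S(β) = ∑ m_i (σ_i -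
tanh (β m_i))`, with `m_i` the local fields. The estimator lies within `L` of `β₀` once `S` has the
right sign at `β₀ ± L` (`abs_mple_sub_le`), that is, once the change of `S` over a distance `L`
exceeds `|S(β₀)|`. The fields are bounded, so for bounded `L` this change is at least a constant
times `L ∑ m_i²`. Two estimates at a common scale `A` then give the rate `√A`
(`exists_prob_mple_le`).

From above, `E S(β₀)² ≤ C A`, by reversing one spin at a time (`expect_score_sq_le`). From below, `∑
m_i²` is of order at least `A`: since `H - S(β₀) ≤ β₀ ∑ m_i²`, it is enough that `H` is not small,
and `P(H ≤ x) ≤ exp (β₀ x / 2 - F)`, so `F ≥ c A` suffices when `A` is large.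

The graph enters only through its degrees, which a Chernoff bound places within a factor `1 ± δ` of
`N p`. If `β₀ > 1`, then `A = N`, and product measures in the Gibbs variational principle give `F ≥
c N`. If `β₀ < 1`, then `A = 1 / p`, the order of the squared Frobenius norm; `E ∑ m_i²` is
comparable to it, and integrating `F'` gives `F ≥ c A`. For bounded `1 / p` the exponential bound is
not small, but only tightness is needed. There `H` is bounded with high probability, so on that
event the Gibbs density relative to uniform spins is bounded. The Littlewood–Offord bound then makes
`|∑ m_i|` of order `√N`, and Cauchy–Schwarz bounds `∑ m_i²` below
(`exists_prob_mple_le_of_frobSq_le`). -/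

namespace Real

/-! ### Slope bounds for `tanh`. -/

lemma hasDerivAt_tanh (x : ℝ) : HasDerivAt tanh (1 / cosh x ^ 2) x := by
  have h := (hasDerivAt_sinh x).div (hasDerivAt_cosh x) (cosh_pos x).ne'
  have e : tanh = sinh / cosh := by
    funext y; simp [tanh_eq_sinh_div_cosh]
  rw [e]
  refine h.congr_deriv ?_
  rw [← cosh_sq_sub_sinh_sq x]; ring

lemma tanh_sub_tanh_le {x y : ℝ} (h : x ≤ y) : tanh y - tanh x ≤ y - x := by
  have := Convex.image_sub_le_mul_sub_of_deriv_le (f := tanh) (C := 1) convex_univ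
    (fun z _ => (hasDerivAt_tanh z).continuousAt.continuousWithinAt)
    (fun z _ => (hasDerivAt_tanh z).differentiableAt.differentiableWithinAt)
    (fun z _ => by
      rw [(hasDerivAt_tanh z).deriv, div_le_one (by positivity)]
      nlinarith [one_le_cosh z]) x trivial y trivial h
  linarith

lemma le_tanh_sub_tanh {M x y : ℝ} (hx : -M ≤ x) (hy : y ≤ M) (h : x ≤ y) :
    1 / cosh M ^ 2 * (y - x) ≤ tanh y - tanh x := by
  refine Convex.mul_sub_le_image_sub_of_le_deriv (f := tanh) (convex_Icc (-M) M)
    (fun z _ => (hasDerivAt_tanh z).continuousAt.continuousWithinAt)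
    (fun z _ => (hasDerivAt_tanh z).differentiableAt.differentiableWithinAt)
    (fun z hz => ?_) x ⟨hx, by linarith⟩ y ⟨by linarith, hy⟩ h
  rw [(hasDerivAt_tanh z).deriv]
  rw [interior_Icc] at hz
  have : cosh z ≤ cosh M := by
    rw [cosh_le_cosh]
    exact (abs_le.2 ⟨hz.1.le, hz.2.le⟩).trans (le_abs_self M)
  have := cosh_pos z
  gcongr

lemma tanh_monotone : Monotone tanh := fun x y h => by
  have := le_tanh_sub_tanh (M := max (-x) y) (by linarith [le_max_left (-x) y])
    (le_max_right _ _) h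
  have h2 : 0 ≤ 1 / cosh (max (-x) y) ^ 2 * (y - x) :=
    mul_nonneg (by positivity) (by linarith)
  linarith

lemma abs_tanh_sub_tanh_le (x y : ℝ) : |tanh x - tanh y| ≤ |x - y| := by
  rcases le_total x y with h | h
  · rw [abs_sub_comm, abs_sub_comm x, abs_of_nonneg (sub_nonneg.2 (tanh_monotone h)),
      abs_of_nonneg (sub_nonneg.2 h)]
    exact tanh_sub_tanh_le h
  · rw [abs_of_nonneg (sub_nonneg.2 (tanh_monotone h)), abs_of_nonneg (sub_nonneg.2 h)]
    exact tanh_sub_tanh_le h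

lemma abs_tanh_le (x : ℝ) : |tanh x| ≤ |x| := by
  simpa using abs_tanh_sub_tanh_le x 0

/-- On `|b x| ≤ M`, the map `b ↦ x tanh (b x)` has slope at least `x² / cosh² M`. -/
lemma le_mul_tanh_sub {M a b x : ℝ} (hab : a ≤ b) (ha : |a * x| ≤ M) (hb : |b * x| ≤ M) :
    1 / cosh M ^ 2 * ((b - a) * x ^ 2) ≤ x * tanh (b * x) - x * tanh (a * x) := by
  rw [abs_le] at ha hb
  rcases le_total 0 x with hx | hx
  · have := mul_le_mul_of_nonneg_left (le_tanh_sub_tanh ha.1 hb.2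
      (mul_le_mul_of_nonneg_right hab hx)) hx
    linarith
  · have := mul_le_mul_of_nonneg_left (le_tanh_sub_tanh hb.1 ha.2
      (mul_le_mul_of_nonpos_right hab hx)) (neg_nonneg.2 hx)
    linarith

lemma mul_tanh_mono {a b : ℝ} (hab : a ≤ b) (x : ℝ) : x * tanh (a * x) ≤ x * tanh (b * x) := by
  have := le_mul_tanh_sub (M := max |a * x| |b * x|) hab (le_max_left _ _) (le_max_right _ _)
  have h2 : 0 ≤ 1 / cosh (max |a * x| |b * x|) ^ 2 * ((b - a) * x ^ 2) :=
    mul_nonneg (by positivity) (mul_nonneg (by linarith) (sq_nonneg _))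
  linarith

end Real

/-! ### Concavity of the pseudolikelihood and localization of the estimator. -/

noncomputable section

namespace Ising

open Real

variable {N : ℕ}

/-- The local field `m_i(τ) = ∑ j, J i j τ_j`. -/
def localField (J : Matrix (Fin N) (Fin N) ℝ) (τ : Config N) (i : Fin N) : ℝ :=
  ∑ j, J i j * spin τ j

/-- The expectation under the Ising model. -/
def expect (J : Matrix (Fin N) (Fin N) ℝ) (β : ℝ) (f : Config N → ℝ) : ℝ :=
  ∑ τ, pmf J β τ * f τ

/-- The derivative of the log-pseudolikelihood. -/
def score (J : Matrix (Fin N) (Fin N) ℝ) (β : ℝ) (τ : Config N) : ℝ :=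
  ∑ i, localField J τ i * (spin τ i - tanh (β * localField J τ i))

/-- The squared norm of the vector of local fields. -/
def fieldSq (J : Matrix (Fin N) (Fin N) ℝ) (τ : Config N) : ℝ :=
  ∑ i, localField J τ i ^ 2

/-- The squared Frobenius norm. -/
def frobSq (J : Matrix (Fin N) (Fin N) ℝ) : ℝ := ∑ i, ∑ j, J i j ^ 2

/-- Symmetric nonnegative interactions without self-interaction, with row sums at most `R`. -/
structure IsFerromagnetic (J : Matrix (Fin N) (Fin N) ℝ) (R : ℝ) : Prop where
  symm : ∀ i j, J i j = J j i
  diag : ∀ i, J i i = 0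
  nonneg : ∀ i j, 0 ≤ J i j
  row_sum_le : ∀ i, ∑ j, J i j ≤ R

lemma spin_eq_one_or (τ : Config N) (i : Fin N) : spin τ i = 1 ∨ spin τ i = -1 := by
  rcases Int.units_eq_one_or (τ i) with h | h <;> simp [spin, h]

lemma spin_mul_self (τ : Config N) (i : Fin N) : spin τ i * spin τ i = 1 := by
  rcases spin_eq_one_or τ i with h | h <;> simp [h]

lemma abs_spin (τ : Config N) (i : Fin N) : |spin τ i| = 1 := by
  rcases spin_eq_one_or τ i with h | h <;> simp [h]

lemma hamiltonian_eq (J : Matrix (Fin N) (Fin N) ℝ) (τ : Config N) :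
    hamiltonian J τ = ∑ i, spin τ i * localField J τ i := by
  simp only [hamiltonian, localField, Finset.mul_sum]
  exact Finset.sum_congr rfl fun i _ => Finset.sum_congr rfl fun j _ => by ring

lemma spin_update (τ : Config N) (i : Fin N) (s : ℤˣ) (j : Fin N) :
    spin (Function.update τ i s) j = spin τ j + if j = i then ((s : ℤ) : ℝ) - spin τ i else 0 := by
  by_cases h : j = i
  · subst h; simp [spin]
  · simp [spin, h]

lemma localField_update (J : Matrix (Fin N) (Fin N) ℝ) (τ : Config N) (i : Fin N) (s : ℤˣ)
    (j : Fin N) : localField J (Function.update τ i s) j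
      = localField J τ j + J j i * (((s : ℤ) : ℝ) - spin τ i) := by
  simp [localField, spin_update, mul_add, Finset.sum_add_distrib]

section
variable {J : Matrix (Fin N) (Fin N) ℝ} {R : ℝ}

/-- Symmetry gives the factor 2, and the zero diagonal removes the term quadratic in the change of
spin. -/
lemma hamiltonian_update (hJ : IsFerromagnetic J R) (τ : Config N) (i : Fin N) (s : ℤˣ) :
    hamiltonian J (Function.update τ i s)
      = hamiltonian J τ + 2 * (((s : ℤ) : ℝ) - spin τ i) * localField J τ i := by
  have h1 : ∑ j, spin τ j * J j i = localField J τ i :=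
    Finset.sum_congr rfl fun j _ => by rw [hJ.symm j i]; ring
  simp only [hamiltonian_eq, localField_update, spin_update, mul_add, add_mul,
    Finset.sum_add_distrib, ite_mul, zero_mul, Finset.sum_ite_eq', Finset.mem_univ, if_true,
    hJ.diag]
  simp only [← mul_assoc, ← Finset.sum_mul, h1]
  ring

lemma partition_pos (J : Matrix (Fin N) (Fin N) ℝ) (β : ℝ) :
    0 < (1 / 2 ^ N) * ∑ τ : Config N, exp (1 / 2 * β * hamiltonian J τ) := by
  have : 0 < ∑ τ : Config N, exp (1 / 2 * β * hamiltonian J τ) :=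
    Finset.sum_pos (fun _ _ => exp_pos _) Finset.univ_nonempty
  positivity

lemma pmf_pos (J : Matrix (Fin N) (Fin N) ℝ) (β : ℝ) (τ : Config N) : 0 < pmf J β τ := by
  unfold pmf; positivity

lemma sum_pmf (J : Matrix (Fin N) (Fin N) ℝ) (β : ℝ) : ∑ τ, pmf J β τ = 1 := by
  have h := partition_pos J β
  simp only [pmf, exp_sub, logPartition, exp_log h]
  rw [← Finset.mul_sum, ← Finset.sum_div, ← mul_div_assoc, div_self h.ne']

lemma pmf_update (hJ : IsFerromagnetic J R) (β : ℝ) (τ : Config N) (i : Fin N) (s : ℤˣ) :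
    pmf J β (Function.update τ i s)
      = pmf J β τ * exp (β * (((s : ℤ) : ℝ) - spin τ i) * localField J τ i) := by
  rw [pmf, pmf, hamiltonian_update hJ, mul_assoc (1 / 2 ^ N : ℝ), ← exp_add]
  ring_nf

lemma condDensity_eq (hJ : IsFerromagnetic J R) (β : ℝ) (τ : Config N) (i : Fin N) :
    condDensity J β τ i = exp (β * localField J τ i * spin τ i
      - log (2 * cosh (β * localField J τ i))) := by
  have hc := cosh_pos (β * localField J τ i)
  have h2 : ∑ s : ℤˣ, pmf J β (Function.update τ i s) = pmf J β τ *
      (exp (-(β * localField J τ i * spin τ i)) * (2 * cosh (β * localField J τ i))) := by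
    simp only [pmf_update hJ, ← Finset.mul_sum]
    congr 1
    have : (Finset.univ : Finset ℤˣ) = {1, -1} := rfl
    rw [this, Finset.sum_pair (by decide), cosh_eq]
    have e : ∀ x : ℝ, exp (-(β * localField J τ i * spin τ i)) * exp x
      = exp (-(β * localField J τ i * spin τ i) + x) := fun x => (exp_add _ _).symm
    rw [mul_div_cancel₀ _ two_ne_zero, mul_add, e, e]
    congr 2 <;> push_cast <;> ring
  rw [condDensity, h2, exp_sub, exp_log (by positivity), exp_neg]
  have := pmf_pos J β τ
  field_simp

/-- The log-pseudolikelihood. -/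
def logPL (J : Matrix (Fin N) (Fin N) ℝ) (β : ℝ) (τ : Config N) : ℝ :=
  ∑ i, (β * localField J τ i * spin τ i - log (2 * cosh (β * localField J τ i)))

lemma pseudoLikelihood_eq (hJ : IsFerromagnetic J R) (β : ℝ) (τ : Config N) :
    pseudoLikelihood J β τ = exp (logPL J β τ) := by
  simp only [pseudoLikelihood, condDensity_eq hJ, logPL, exp_sum]

lemma hasDerivAt_logPL (J : Matrix (Fin N) (Fin N) ℝ) (τ : Config N) (β : ℝ) :
    HasDerivAt (fun b => logPL J b τ) (score J β τ) β := by
  unfold logPL score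
  refine HasDerivAt.fun_sum fun i _ => ?_
  set m := localField J τ i
  have h1 : HasDerivAt (fun b : ℝ => b * m) m β := by simpa using (hasDerivAt_id β).mul_const m
  have h2 : HasDerivAt (fun b : ℝ => b * m * spin τ i) (m * spin τ i) β := h1.mul_const _
  have hc := cosh_pos (β * m)
  have h3 := (((hasDerivAt_cosh (β * m)).comp β h1).const_mul 2).log (by simp; positivity)
  refine (h2.sub h3).congr_deriv ?_
  simp only [Function.comp, tanh_eq_sinh_div_cosh]
  field_simp

lemma score_antitone (J : Matrix (Fin N) (Fin N) ℝ) (τ : Config N) :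
    Antitone fun β => score J β τ := fun a b hab => by
  refine Finset.sum_le_sum fun i _ => ?_
  have := mul_tanh_mono hab (localField J τ i)
  linarith

lemma logPL_strictAntiOn {τ : Config N} {b : ℝ} (h : score J b τ < 0) :
    StrictAntiOn (fun β => logPL J β τ) (Set.Ici b) := by
  refine strictAntiOn_of_deriv_neg (convex_Ici b)
    (fun x _ => (hasDerivAt_logPL J τ x).continuousAt.continuousWithinAt) fun x hx => ?_
  rw [(hasDerivAt_logPL J τ x).deriv]
  exact (score_antitone J τ (interior_subset hx)).trans_lt h

lemma logPL_strictMonoOn {τ : Config N} {b : ℝ} (h : 0 < score J b τ) :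
    StrictMonoOn (fun β => logPL J β τ) (Set.Iic b) := by
  refine strictMonoOn_of_deriv_pos (convex_Iic b)
    (fun x _ => (hasDerivAt_logPL J τ x).continuousAt.continuousWithinAt) fun x hx => ?_
  rw [(hasDerivAt_logPL J τ x).deriv]
  exact h.trans_le (score_antitone J τ (interior_subset (s := Set.Iic b) hx))

lemma isMaxOn_pseudoLikelihood_iff (hJ : IsFerromagnetic J R) (τ : Config N) (x : ℝ) :
    IsMaxOn (fun β : ℝ => pseudoLikelihood J β τ) (Set.Ici 0) x ↔
      ∀ y, 0 ≤ y → logPL J y τ ≤ logPL J x τ := by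
  simp [isMaxOn_iff, pseudoLikelihood_eq hJ]

/-- A negative score to the right of `β` and a positive one to its left localize the estimator. -/
lemma abs_mple_sub_le (hJ : IsFerromagnetic J R) {τ : Config N} {β L : ℝ} (hβ : 0 ≤ β)
    (hL : 0 < L) (hr : score J (β + L) τ < 0) (hl : L < β → 0 < score J (β - L) τ) :
    (mple J τ - (β : EReal)).abs ≤ ENNReal.ofReal L := by
  -- Compactness gives a maximizer on `[0, β + L]`. It is global because the log-pseudolikelihood
  -- decreases beyond `β + L`, so the infimum defining `mple` is over a nonempty set.
  obtain ⟨x, hx, hmax⟩ := isCompact_Icc.exists_isMaxOn (Set.nonempty_Icc.2 (by linarith :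
    0 ≤ β + L)) (f := fun b => logPL J b τ)
    (fun x _ => (hasDerivAt_logPL J τ x).continuousAt.continuousWithinAt)
  have hxmax : ∀ y, 0 ≤ y → logPL J y τ ≤ logPL J x τ := fun y hy => by
    rcases le_total y (β + L) with h | h
    · exact hmax ⟨hy, h⟩
    · exact ((logPL_strictAntiOn hr).antitoneOn Set.self_mem_Ici h h).trans
        (hmax ⟨by linarith, le_rfl⟩)
  have hle : mple J τ ≤ (x : EReal) :=
    sInf_le ⟨x, rfl, hx.1, (isMaxOn_pseudoLikelihood_iff hJ τ x).2 hxmax⟩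
  -- A maximizer `y ≥ 0` below `β - L` can exist only if `L < β`, which is why `hl` is conditional.
  have hge : ((β - L : ℝ) : EReal) ≤ mple J τ := by
    refine le_sInf ?_
    rintro _ ⟨y, rfl, hy0, hy⟩
    rw [isMaxOn_pseudoLikelihood_iff hJ] at hy
    rw [EReal.coe_le_coe_iff]
    by_contra! hlt
    have := logPL_strictMonoOn (hl (by linarith)) hlt.le Set.self_mem_Iic hlt
    exact absurd (hy (β - L) (by linarith)) (not_le.2 this)
  have hb : mple J τ ≠ ⊥ := fun h => by
    rw [h, le_bot_iff] at hge; exact EReal.coe_ne_bot _ hge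
  have ht : mple J τ ≠ ⊤ := fun h => by rw [h] at hle; simp at hle
  lift mple J τ to ℝ using ⟨ht, hb⟩ with y
  rw [EReal.coe_le_coe_iff] at hle hge
  rw [← EReal.coe_sub, EReal.abs_def]
  exact ENNReal.ofReal_le_ofReal (abs_le.2 ⟨by linarith, by linarith [hx.2]⟩)

end

end Ising

/-! ### Spin reversal, moments of the local fields and of the score. -/

namespace Ising

open Real

variable {N : ℕ} {J : Matrix (Fin N) (Fin N) ℝ} {R β : ℝ}

lemma expect_add (J : Matrix (Fin N) (Fin N) ℝ) (β : ℝ) (f g : Config N → ℝ) :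
    expect J β (fun τ => f τ + g τ) = expect J β f + expect J β g := by
  simp [expect, mul_add, Finset.sum_add_distrib]

lemma expect_sub (J : Matrix (Fin N) (Fin N) ℝ) (β : ℝ) (f g : Config N → ℝ) :
    expect J β (fun τ => f τ - g τ) = expect J β f - expect J β g := by
  simp [expect, mul_sub]

lemma expect_const (J : Matrix (Fin N) (Fin N) ℝ) (β c : ℝ) : expect J β (fun _ => c) = c := by
  simp [expect, ← Finset.sum_mul, sum_pmf]

lemma expect_const_mul (J : Matrix (Fin N) (Fin N) ℝ) (β c : ℝ) (f : Config N → ℝ) :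
    expect J β (fun τ => c * f τ) = c * expect J β f := by
  simp only [expect, Finset.mul_sum]
  exact Finset.sum_congr rfl fun τ _ => by ring

lemma expect_sum {ι : Type*} (J : Matrix (Fin N) (Fin N) ℝ) (β : ℝ) (s : Finset ι)
    (f : ι → Config N → ℝ) :
    expect J β (fun τ => ∑ i ∈ s, f i τ) = ∑ i ∈ s, expect J β (f i) := by
  simp only [expect, Finset.mul_sum]
  exact Finset.sum_comm

lemma expect_mono (J : Matrix (Fin N) (Fin N) ℝ) (β : ℝ) {f g : Config N → ℝ}
    (h : ∀ τ, f τ ≤ g τ) : expect J β f ≤ expect J β g :=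
  Finset.sum_le_sum fun τ _ => mul_le_mul_of_nonneg_left (h τ) (pmf_pos J β τ).le

lemma expect_nonneg (J : Matrix (Fin N) (Fin N) ℝ) (β : ℝ) {f : Config N → ℝ}
    (h : ∀ τ, 0 ≤ f τ) : 0 ≤ expect J β f :=
  Finset.sum_nonneg fun τ _ => mul_nonneg (pmf_pos J β τ).le (h τ)

lemma prob_le_expect (J : Matrix (Fin N) (Fin N) ℝ) (β : ℝ) {f : Config N → ℝ}
    {E : Set (Config N)} (h0 : ∀ τ, 0 ≤ f τ) (h : ∀ τ ∈ E, 1 ≤ f τ) :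
    prob J β E ≤ expect J β f := by
  refine Finset.sum_le_sum fun τ _ => ?_
  have hp := (pmf_pos J β τ).le
  by_cases hτ : τ ∈ E
  · rw [Set.indicator_of_mem hτ]; exact le_mul_of_one_le_right hp (h τ hτ)
  · rw [Set.indicator_of_notMem hτ]; exact mul_nonneg hp (h0 τ)

lemma prob_mono (J : Matrix (Fin N) (Fin N) ℝ) (β : ℝ) {A B : Set (Config N)} (h : A ⊆ B) :
    prob J β A ≤ prob J β B :=
  Finset.sum_le_sum fun τ _ =>
    Set.indicator_le_indicator_of_subset h (fun τ => (pmf_pos J β τ).le) τ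

lemma prob_union_le (J : Matrix (Fin N) (Fin N) ℝ) (β : ℝ) (A B : Set (Config N)) :
    prob J β (A ∪ B) ≤ prob J β A + prob J β B := by
  rw [prob, prob, prob, ← Finset.sum_add_distrib]
  refine Finset.sum_le_sum fun τ _ => ?_
  have hp := (pmf_pos J β τ).le
  by_cases hA : τ ∈ A <;> by_cases hB : τ ∈ B <;> simp [hA, hB, hp]

/-- Markov's inequality. -/
lemma prob_lt_le (J : Matrix (Fin N) (Fin N) ℝ) (β : ℝ) {f : Config N → ℝ} (h0 : ∀ τ, 0 ≤ f τ)
    {c : ℝ} (hc : 0 < c) : prob J β {τ | c < f τ} ≤ expect J β f / c := by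
  have := prob_le_expect J β (f := fun τ => c⁻¹ * f τ) (E := {τ | c < f τ})
    (fun τ => mul_nonneg (by positivity) (h0 τ))
    (fun τ hτ => by
      rw [inv_mul_eq_div, le_div_iff₀ hc, one_mul]; exact le_of_lt hτ)
  rwa [expect_const_mul, inv_mul_eq_div] at this

/-- Reversal of the spin at `i`. -/
def flip (i : Fin N) (τ : Config N) : Config N := Function.update τ i (-τ i)

lemma flip_flip (i : Fin N) (τ : Config N) : flip i (flip i τ) = τ := by
  simp [flip]

lemma cast_neg_sub_spin (τ : Config N) (i : Fin N) :
    (((-τ i : ℤˣ) : ℤ) : ℝ) - spin τ i = -2 * spin τ i := by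
  simp [spin]; ring

lemma spin_flip_self (i : Fin N) (τ : Config N) : spin (flip i τ) i = -spin τ i := by
  rw [flip, spin_update, if_pos rfl, cast_neg_sub_spin]; ring

lemma localField_flip (J : Matrix (Fin N) (Fin N) ℝ) (τ : Config N) (i j : Fin N) :
    localField J (flip i τ) j = localField J τ j - 2 * J j i * spin τ i := by
  rw [flip, localField_update, cast_neg_sub_spin]; ring

lemma localField_flip_self (hJ : IsFerromagnetic J R) (τ : Config N) (i : Fin N) :
    localField J (flip i τ) i = localField J τ i := by
  rw [localField_flip, hJ.diag]; ring

lemma hamiltonian_flip (hJ : IsFerromagnetic J R) (τ : Config N) (i : Fin N) :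
    hamiltonian J (flip i τ) = hamiltonian J τ - 4 * spin τ i * localField J τ i := by
  rw [flip, hamiltonian_update hJ, cast_neg_sub_spin]; ring

lemma pmf_flip (hJ : IsFerromagnetic J R) (β : ℝ) (τ : Config N) (i : Fin N) :
    pmf J β (flip i τ) = pmf J β τ * exp (-2 * spin τ i * (β * localField J τ i)) := by
  rw [flip, pmf_update hJ, cast_neg_sub_spin]; ring_nf

lemma sum_flip (i : Fin N) (f : Config N → ℝ) : ∑ τ, f (flip i τ) = ∑ τ, f τ :=
  Equiv.sum_comp (Function.Involutive.toPerm (flip i) (flip_flip i)) f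

lemma spin_sub_tanh_add (τ : Config N) (i : Fin N) (x : ℝ) :
    (spin τ i - tanh x) + exp (-2 * spin τ i * x) * (-spin τ i - tanh x) = 0 := by
  have h : 0 < exp x + exp (-x) := by positivity
  have e2 : exp (2 * x) = exp x * exp x := by rw [← exp_add]; ring_nf
  have e3 : exp (-(2 * x)) = exp (-x) * exp (-x) := by rw [← exp_add]; ring_nf
  have e1 : exp x * exp (-x) = 1 := by rw [← exp_add]; simp
  rcases spin_eq_one_or τ i with hs | hs <;> rw [hs, tanh_eq]
  · have : -2 * 1 * x = -(2 * x) := by ring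
    rw [this, e3]
    field_simp
    linear_combination (2 * -exp (-x)) * e1
  · have : -2 * -1 * x = 2 * x := by ring
    rw [this, e2]
    field_simp
    linear_combination (2 * exp x) * e1

/-- Given the other spins, `σ_i` has mean `tanh (β m_i)`. -/
lemma expect_spin_sub_tanh_mul (hJ : IsFerromagnetic J R) (β : ℝ) (i : Fin N)
    (g : Config N → ℝ) :
    expect J β (fun τ => (spin τ i - tanh (β * localField J τ i)) * g τ) =
      expect J β (fun τ => (spin τ i - tanh (β * localField J τ i)) *
        ((g τ - g (flip i τ)) / 2)) := by
  -- The part of `g` symmetric under the flip averages to zero, as the terms at `τ` and `flip i τ`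
  -- cancel; only the antisymmetric part survives.
  have key : ∑ τ, pmf J β τ * ((spin τ i - tanh (β * localField J τ i)) *
      ((g τ + g (flip i τ)) / 2)) = 0 := by
    set F := fun τ => pmf J β τ * ((spin τ i - tanh (β * localField J τ i)) *
      ((g τ + g (flip i τ)) / 2)) with hF
    have h1 : ∑ τ, (F τ + F (flip i τ)) = 0 := by
      refine Finset.sum_eq_zero fun τ _ => ?_
      simp only [hF, flip_flip, pmf_flip hJ, spin_flip_self, localField_flip_self hJ]
      have := spin_sub_tanh_add τ i (β * localField J τ i)
      linear_combination (pmf J β τ * ((g τ + g (flip i τ)) / 2)) * this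
    rw [Finset.sum_add_distrib, sum_flip i F] at h1
    linarith
  rw [expect, expect, ← sub_eq_zero, ← Finset.sum_sub_distrib, ← key]
  exact Finset.sum_congr rfl fun τ _ => by ring

lemma expect_spin_mul (hJ : IsFerromagnetic J R) (β : ℝ) (i : Fin N) {g : Config N → ℝ}
    (hg : ∀ τ, g (flip i τ) = g τ) :
    expect J β (fun τ => spin τ i * g τ) =
      expect J β (fun τ => tanh (β * localField J τ i) * g τ) := by
  have := expect_spin_sub_tanh_mul hJ β i g
  simp only [hg, sub_self, zero_div, mul_zero, sub_mul, expect_sub, expect_const] at this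
  linarith

lemma expect_hamiltonian (hJ : IsFerromagnetic J R) (β : ℝ) :
    expect J β (hamiltonian J) =
      expect J β (fun τ => ∑ i, localField J τ i * tanh (β * localField J τ i)) := by
  have : hamiltonian J = fun τ => ∑ i, spin τ i * localField J τ i := by
    funext τ; exact hamiltonian_eq J τ
  rw [this, expect_sum, expect_sum]
  refine Finset.sum_congr rfl fun i _ => ?_
  rw [expect_spin_mul hJ β i (localField_flip_self hJ · i)]
  simp only [mul_comm]

/-- This is the flip identity for `σ_j` with `g = m_i`. Reversing `σ_j` moves `m_i` by `2 J_ij σ_j`,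
which produces the correction term. -/
lemma expect_localField_mul_spin (hJ : IsFerromagnetic J R) (β : ℝ) (i j : Fin N) :
    expect J β (fun τ => spin τ j * localField J τ i) =
      expect J β (fun τ => tanh (β * localField J τ j) * localField J τ i)
        + J i j * (1 - expect J β (fun τ => tanh (β * localField J τ j) ^ 2)) := by
  have h1 := expect_spin_sub_tanh_mul hJ β j (fun τ => localField J τ i)
  have h2 : ∀ τ, (spin τ j - tanh (β * localField J τ j)) *
      ((localField J τ i - localField J (flip j τ) i) / 2) =
      J i j * (1 - spin τ j * tanh (β * localField J τ j)) := fun τ => by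
    rw [localField_flip]
    linear_combination J i j * spin_mul_self τ j
  have h3 := expect_spin_mul hJ β j (g := fun τ => tanh (β * localField J τ j))
    fun τ => by rw [localField_flip_self hJ]
  simp only [h2, expect_const_mul, sub_mul, expect_sub, expect_const, h3] at h1
  simp only [pow_two]
  linarith

lemma fieldSq_nonneg (J : Matrix (Fin N) (Fin N) ℝ) (τ : Config N) : 0 ≤ fieldSq J τ :=
  Finset.sum_nonneg fun _ _ => sq_nonneg _

/-- Expand one factor of `m_i²` as `∑ j, J_ij σ_j` and average each `σ_j` given the rest. The
corrections add up to the Frobenius norm less a `tanh²` term; both bounds on the local fields come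
from this identity. -/
lemma expect_fieldSq (hJ : IsFerromagnetic J R) (β : ℝ) :
    expect J β (fieldSq J) =
      expect J β (fun τ => ∑ i, ∑ j, J i j * (tanh (β * localField J τ j) * localField J τ i))
      + (frobSq J - expect J β (fun τ => ∑ i, ∑ j, J i j ^ 2 *
        tanh (β * localField J τ j) ^ 2)) := by
  have h : fieldSq J = fun τ => ∑ i, ∑ j, J i j * (spin τ j * localField J τ i) := by
    funext τ
    refine Finset.sum_congr rfl fun i _ => ?_
    rw [pow_two]
    nth_rw 1 [localField]
    rw [Finset.sum_mul]
    exact Finset.sum_congr rfl fun j _ => by ring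
  rw [h, frobSq]
  simp only [expect_sum, expect_const_mul, expect_localField_mul_spin hJ]
  simp only [← Finset.sum_sub_distrib, ← Finset.sum_add_distrib]
  exact Finset.sum_congr rfl fun i _ => Finset.sum_congr rfl fun j _ => by ring

/-- Schur's test: the arithmetic-geometric mean inequality and the row sum bound. -/
lemma sum_mul_abs_le (hJ : IsFerromagnetic J R) (x : Fin N → ℝ) :
    ∑ i, ∑ j, J i j * (|x j| * |x i|) ≤ R * ∑ i, x i ^ 2 := by
  have h1 : ∑ i, ∑ j, J i j * (|x j| * |x i|) ≤
      ∑ i, ∑ j, (J i j * (x i ^ 2 / 2) + J i j * (x j ^ 2 / 2)) := by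
    refine Finset.sum_le_sum fun i _ => Finset.sum_le_sum fun j _ => ?_
    rw [← mul_add]
    refine mul_le_mul_of_nonneg_left ?_ (hJ.nonneg i j)
    nlinarith [sq_nonneg (|x j| - |x i|), sq_abs (x i), sq_abs (x j)]
  have h2 : ∑ i, ∑ j, J i j * (x j ^ 2 / 2) = ∑ i, ∑ j, J i j * (x i ^ 2 / 2) := by
    rw [Finset.sum_comm]
    exact Finset.sum_congr rfl fun i _ => Finset.sum_congr rfl fun j _ => by rw [hJ.symm]
  have h3 : ∑ i, ∑ j, J i j * (x i ^ 2 / 2) ≤ ∑ i, R * (x i ^ 2 / 2) := by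
    refine Finset.sum_le_sum fun i _ => ?_
    rw [← Finset.sum_mul]
    exact mul_le_mul_of_nonneg_right (hJ.row_sum_le i) (by positivity)
  simp only [Finset.sum_add_distrib, h2] at h1
  rw [← Finset.mul_sum, ← Finset.sum_div] at h3
  linarith

lemma abs_tanh_mul_le (hβ : 0 ≤ β) (x : ℝ) : |tanh (β * x)| ≤ β * |x| := by
  simpa [abs_mul, abs_of_nonneg hβ] using abs_tanh_le (β * x)

lemma abs_sum_mul_tanh_le (hJ : IsFerromagnetic J R) (hβ : 0 ≤ β) (τ : Config N) :
    |∑ i, ∑ j, J i j * (tanh (β * localField J τ j) * localField J τ i)|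
      ≤ β * R * fieldSq J τ := by
  calc _ ≤ ∑ i, ∑ j, |J i j * (tanh (β * localField J τ j) * localField J τ i)| :=
        (Finset.abs_sum_le_sum_abs _ _).trans
          (Finset.sum_le_sum fun i _ => Finset.abs_sum_le_sum_abs _ _)
    _ ≤ ∑ i, ∑ j, β * (J i j * (|localField J τ j| * |localField J τ i|)) := by
        refine Finset.sum_le_sum fun i _ => Finset.sum_le_sum fun j _ => ?_
        rw [abs_mul, abs_mul, abs_of_nonneg (hJ.nonneg i j)]
        have := mul_le_mul_of_nonneg_left (mul_le_mul_of_nonneg_right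
          (abs_tanh_mul_le hβ (localField J τ j)) (abs_nonneg (localField J τ i)))
          (hJ.nonneg i j)
        linarith
    _ ≤ _ := by
        simp only [← Finset.mul_sum]
        rw [mul_assoc]
        exact mul_le_mul_of_nonneg_left (sum_mul_abs_le hJ _) hβ

/-- High temperature bound on the local fields. -/
lemma expect_fieldSq_le (hJ : IsFerromagnetic J R) (hβ : 0 ≤ β) :
    (1 - β * R) * expect J β (fieldSq J) ≤ frobSq J := by
  have h1 := expect_fieldSq hJ β
  have h2 := expect_mono J β fun τ => (abs_le.1 (abs_sum_mul_tanh_le hJ hβ τ)).2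
  have h3 : 0 ≤ expect J β (fun τ => ∑ i, ∑ j, J i j ^ 2 * tanh (β * localField J τ j) ^ 2) :=
    expect_nonneg J β fun τ => by positivity
  rw [expect_const_mul] at h2
  linarith

lemma entry_le (hJ : IsFerromagnetic J R) (i j : Fin N) : J i j ≤ R :=
  (Finset.single_le_sum (f := fun j => J i j) (fun j _ => hJ.nonneg i j)
    (Finset.mem_univ j)).trans (hJ.row_sum_le i)

lemma sum_sq_le (hJ : IsFerromagnetic J R) (j : Fin N) : ∑ i, J i j ^ 2 ≤ R ^ 2 := by
  have hR : 0 ≤ R := (hJ.nonneg j j).trans (entry_le hJ j j)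
  calc ∑ i, J i j ^ 2 ≤ ∑ i, R * J j i := Finset.sum_le_sum fun i _ => by
        rw [pow_two, hJ.symm j i]
        exact mul_le_mul_of_nonneg_right (entry_le hJ i j) (hJ.nonneg i j)
    _ ≤ R ^ 2 := by
        rw [← Finset.mul_sum, pow_two]
        exact mul_le_mul_of_nonneg_left (hJ.row_sum_le j) hR

/-- In this direction `β R` need not be small: the cross term and the `tanh²` correction are both at
most multiples of `fieldSq`. -/
lemma le_expect_fieldSq (hJ : IsFerromagnetic J R) (hβ : 0 ≤ β) :
    frobSq J ≤ (1 + β * R + β ^ 2 * R ^ 2) * expect J β (fieldSq J) := by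
  have h1 := expect_fieldSq hJ β
  have h2 := expect_mono J β fun τ => (abs_le.1 (abs_sum_mul_tanh_le hJ hβ τ)).1
  have h3 : expect J β (fun τ => ∑ i, ∑ j, J i j ^ 2 * tanh (β * localField J τ j) ^ 2)
      ≤ expect J β (fun τ => β ^ 2 * R ^ 2 * fieldSq J τ) := by
    refine expect_mono J β fun τ => ?_
    rw [Finset.sum_comm, fieldSq, Finset.mul_sum]
    refine Finset.sum_le_sum fun j _ => ?_
    rw [← Finset.sum_mul]
    have ht : tanh (β * localField J τ j) ^ 2 ≤ β ^ 2 * localField J τ j ^ 2 := by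
      rw [← sq_abs, ← sq_abs (localField J τ j), ← mul_pow]
      exact pow_le_pow_left₀ (abs_nonneg _) (abs_tanh_mul_le hβ _) 2
    calc _ ≤ R ^ 2 * (β ^ 2 * localField J τ j ^ 2) :=
          mul_le_mul (sum_sq_le hJ j) ht (sq_nonneg _) (sq_nonneg _)
      _ = _ := by ring
  have h4 : expect J β (fun τ => -(β * R * fieldSq J τ)) = -(β * R * expect J β (fieldSq J)) := by
    have := expect_const_mul J β (-(β * R)) (fieldSq J)
    simpa [neg_mul] using this
  rw [expect_const_mul] at h3
  rw [h4] at h2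
  linarith

lemma abs_localField_le (hJ : IsFerromagnetic J R) (τ : Config N) (i : Fin N) :
    |localField J τ i| ≤ R := by
  refine (Finset.abs_sum_le_sum_abs _ _).trans (le_trans (le_of_eq ?_) (hJ.row_sum_le i))
  exact Finset.sum_congr rfl fun j _ => by
    rw [abs_mul, abs_spin, mul_one, abs_of_nonneg (hJ.nonneg i j)]

lemma expect_fieldSq_le_card (hJ : IsFerromagnetic J R) (β : ℝ) :
    expect J β (fieldSq J) ≤ N * R ^ 2 := by
  rw [← expect_const J β (N * R ^ 2)]
  refine expect_mono J β fun τ => ?_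
  calc fieldSq J τ ≤ ∑ i : Fin N, R ^ 2 := Finset.sum_le_sum fun i _ => by
        rw [← sq_abs]; exact pow_le_pow_left₀ (abs_nonneg _) (abs_localField_le hJ τ i) 2
    _ = _ := by simp

lemma score_eq (J : Matrix (Fin N) (Fin N) ℝ) (β : ℝ) (τ : Config N) :
    score J β τ = hamiltonian J τ - ∑ i, localField J τ i * tanh (β * localField J τ i) := by
  rw [hamiltonian_eq, ← Finset.sum_sub_distrib]
  exact Finset.sum_congr rfl fun i _ => by ring

lemma abs_mul_tanh_sub_le (hβ : 0 ≤ β) (x y : ℝ) :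
    |x * tanh (β * x) - y * tanh (β * y)| ≤ β * (|x| + |y|) * |x - y| := by
  have e : x * tanh (β * x) - y * tanh (β * y)
      = (x - y) * tanh (β * x) + y * (tanh (β * x) - tanh (β * y)) := by ring
  have h1 : |(x - y) * tanh (β * x)| ≤ |x - y| * (β * |x|) := by
    rw [abs_mul]; exact mul_le_mul_of_nonneg_left (abs_tanh_mul_le hβ x) (abs_nonneg _)
  have h2 : |y * (tanh (β * x) - tanh (β * y))| ≤ |y| * (β * |x - y|) := by
    rw [abs_mul]
    refine mul_le_mul_of_nonneg_left ?_ (abs_nonneg _)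
    have := abs_tanh_sub_tanh_le (β * x) (β * y)
    rwa [← mul_sub, abs_mul, abs_of_nonneg hβ] at this
  rw [e]
  exact (abs_add_le _ _).trans (by linarith)

/-- Each `m_j` moves by `2 J_ij`. The bound keeps the factors `|m_j|` instead of replacing them by
`R`, so that the second moment of the score is controlled by `fieldSq` and `frobSq` rather than by
`N`. -/
lemma abs_score_sub_flip_le (hJ : IsFerromagnetic J R) (hβ : 0 ≤ β) (τ : Config N) (i : Fin N) :
    |score J β τ - score J β (flip i τ)| ≤ 4 * |localField J τ i|
      + 4 * β * ∑ j, (J i j * |localField J τ j| + J i j ^ 2) := by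
  set A := ∑ j, (localField J τ j * tanh (β * localField J τ j)
    - localField J (flip i τ) j * tanh (β * localField J (flip i τ) j)) with hA
  have e : score J β τ - score J β (flip i τ) = 4 * spin τ i * localField J τ i - A := by
    rw [score_eq, score_eq, hamiltonian_flip hJ, hA, Finset.sum_sub_distrib]; ring
  have h1 : |4 * spin τ i * localField J τ i| = 4 * |localField J τ i| := by
    rw [abs_mul, abs_mul, abs_spin]; norm_num
  have h2 : |A| ≤ 4 * β * ∑ j, (J i j * |localField J τ j| + J i j ^ 2) := by
    rw [Finset.mul_sum]
    refine (Finset.abs_sum_le_sum_abs _ _).trans (Finset.sum_le_sum fun j _ => ?_)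
    refine (abs_mul_tanh_sub_le hβ _ _).trans ?_
    have hJ0 := hJ.nonneg i j
    have h3 : |localField J τ j - localField J (flip i τ) j| = 2 * J i j := by
      rw [localField_flip, hJ.symm j i, sub_sub_cancel, abs_mul, abs_spin, mul_one,
        abs_of_nonneg (by linarith)]
    have h4 : |localField J (flip i τ) j| ≤ |localField J τ j| + 2 * J i j := by
      rw [← h3, abs_sub_comm]
      have := abs_add_le (localField J τ j) (localField J (flip i τ) j - localField J τ j)
      rwa [add_sub_cancel] at this
    rw [h3]
    have := mul_le_mul_of_nonneg_left h4 (mul_nonneg hβ hJ0)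
    nlinarith
  rw [e]
  exact (abs_sub _ _).trans (by linarith)

/-- Write one factor of the square as `∑ i, (σ_i - tanh (β m_i)) m_i` and apply the flip identity
with `g = m_i S`. As `m_i` does not see `σ_i`, only the discrete derivative of `S` remains. -/
lemma expect_score_sq_le (hJ : IsFerromagnetic J R) (hβ : 0 ≤ β) :
    expect J β (fun τ => score J β τ ^ 2) ≤
      (4 + 4 * β * R) * expect J β (fieldSq J) + 4 * β * R * frobSq J := by
  have e1 : (fun τ => score J β τ ^ 2) = fun τ => ∑ i,
      (spin τ i - tanh (β * localField J τ i)) * (localField J τ i * score J β τ) := by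
    funext τ
    rw [pow_two]
    nth_rw 1 [score]
    rw [Finset.sum_mul]
    exact Finset.sum_congr rfl fun i _ => by ring
  have e2 : expect J β (fun τ => score J β τ ^ 2) = expect J β (fun τ => ∑ i,
      (spin τ i - tanh (β * localField J τ i)) *
        (localField J τ i * (score J β τ - score J β (flip i τ)) / 2)) := by
    rw [e1, expect_sum, expect_sum]
    refine Finset.sum_congr rfl fun i _ => ?_
    rw [expect_spin_sub_tanh_mul hJ]
    simp only [localField_flip_self hJ, mul_sub]
  rw [e2]
  have key : ∀ τ, ∑ i, (spin τ i - tanh (β * localField J τ i)) *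
        (localField J τ i * (score J β τ - score J β (flip i τ)) / 2) ≤
        (4 + 4 * β * R) * fieldSq J τ + 4 * β * R * frobSq J := fun τ => by
    have h1 : ∀ i, (spin τ i - tanh (β * localField J τ i)) *
        (localField J τ i * (score J β τ - score J β (flip i τ)) / 2) ≤
        4 * localField J τ i ^ 2
          + 4 * β * ∑ j, J i j * (|localField J τ j| * |localField J τ i|)
          + 4 * β * (R * ∑ j, J i j ^ 2) := fun i => by
      have a1 : |spin τ i - tanh (β * localField J τ i)| ≤ 2 := by
        have := abs_sub (spin τ i) (tanh (β * localField J τ i))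
        rw [abs_spin] at this
        linarith [abs_tanh_lt_one (β * localField J τ i)]
      have a2 := abs_score_sub_flip_le hJ hβ τ i
      have a3 : (∑ j, J i j ^ 2) * |localField J τ i| ≤ R * ∑ j, J i j ^ 2 := by
        rw [mul_comm]
        exact mul_le_mul_of_nonneg_right (abs_localField_le hJ τ i) (by positivity)
      refine (le_abs_self _).trans ?_
      rw [abs_mul, abs_div, abs_mul, abs_two]
      calc _ ≤ 2 * (|localField J τ i| * |score J β τ - score J β (flip i τ)| / 2) :=
            mul_le_mul_of_nonneg_right a1 (by positivity)
        _ = |localField J τ i| * |score J β τ - score J β (flip i τ)| := by ring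
        _ ≤ |localField J τ i| * (4 * |localField J τ i|
            + 4 * β * ∑ j, (J i j * |localField J τ j| + J i j ^ 2)) :=
            mul_le_mul_of_nonneg_left a2 (abs_nonneg _)
        _ = 4 * |localField J τ i| ^ 2
          + 4 * β * ∑ j, J i j * (|localField J τ j| * |localField J τ i|)
          + 4 * β * ((∑ j, J i j ^ 2) * |localField J τ i|) := by
            simp only [← mul_assoc, ← Finset.sum_mul]
            rw [Finset.sum_add_distrib]
            ring
        _ ≤ _ := by
            rw [sq_abs]
            have := mul_le_mul_of_nonneg_left a3 (by positivity : 0 ≤ 4 * β)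
            linarith
    refine (Finset.sum_le_sum fun i _ => h1 i).trans ?_
    simp only [Finset.sum_add_distrib, ← Finset.mul_sum]
    have := mul_le_mul_of_nonneg_left (sum_mul_abs_le hJ (localField J τ))
      (by positivity : 0 ≤ 4 * β)
    simp only [fieldSq, frobSq]
    linarith
  refine (expect_mono J β key).trans ?_
  rw [expect_add, expect_const_mul, expect_const]

/-! ### The log-partition function and lower tails of the Hamiltonian. -/

lemma hasDerivAt_logPartition (J : Matrix (Fin N) (Fin N) ℝ) (β : ℝ) :
    HasDerivAt (logPartition J) (expect J β (hamiltonian J) / 2) β := by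
  have hZ := partition_pos J β
  have h1 : HasDerivAt (fun b : ℝ => (1 / 2 ^ N) * ∑ τ : Config N,
      exp (1 / 2 * b * hamiltonian J τ)) ((1 / 2 ^ N) * ∑ τ : Config N,
      exp (1 / 2 * β * hamiltonian J τ) * (1 / 2 * hamiltonian J τ)) β := by
    refine (HasDerivAt.fun_sum fun τ _ => ?_).const_mul _
    refine HasDerivAt.exp ?_
    simpa using ((hasDerivAt_id β).const_mul (1 / 2 : ℝ)).mul_const (hamiltonian J τ)
  refine (h1.log hZ.ne').congr_deriv ?_
  simp only [expect, pmf, exp_sub, logPartition, exp_log hZ]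
  rw [Finset.mul_sum, Finset.sum_div, Finset.sum_div]
  exact Finset.sum_congr rfl fun τ _ => by ring

lemma logPartition_zero (J : Matrix (Fin N) (Fin N) ℝ) : logPartition J 0 = 0 := by
  simp [logPartition]

lemma mul_tanh_nonneg (hβ : 0 ≤ β) (x : ℝ) : 0 ≤ x * tanh (β * x) := by
  simpa using mul_tanh_mono hβ x

lemma expect_hamiltonian_nonneg (hJ : IsFerromagnetic J R) (hβ : 0 ≤ β) :
    0 ≤ expect J β (hamiltonian J) := by
  rw [expect_hamiltonian hJ]
  exact expect_nonneg J β fun τ => Finset.sum_nonneg fun i _ => mul_tanh_nonneg hβ _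

lemma logPartition_mono (hJ : IsFerromagnetic J R) : MonotoneOn (logPartition J) (Set.Ici 0) := by
  refine monotoneOn_of_deriv_nonneg (convex_Ici 0)
    (fun x _ => (hasDerivAt_logPartition J x).continuousAt.continuousWithinAt)
    (fun x _ => (hasDerivAt_logPartition J x).differentiableAt.differentiableWithinAt)
    fun x hx => ?_
  rw [(hasDerivAt_logPartition J x).deriv]
  have := expect_hamiltonian_nonneg hJ (interior_subset (s := Set.Ici 0) hx)
  positivity

lemma logPartition_nonneg (hJ : IsFerromagnetic J R) (hβ : 0 ≤ β) : 0 ≤ logPartition J β := by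
  rw [← logPartition_zero J]
  exact logPartition_mono hJ Set.self_mem_Ici hβ hβ

lemma sum_mul_tanh_le (hβ : 0 ≤ β) (τ : Config N) :
    ∑ i, localField J τ i * tanh (β * localField J τ i) ≤ β * fieldSq J τ := by
  rw [fieldSq, Finset.mul_sum]
  refine Finset.sum_le_sum fun i _ => ?_
  refine (le_abs_self _).trans ?_
  rw [abs_mul]
  have := mul_le_mul_of_nonneg_left (abs_tanh_mul_le hβ (localField J τ i))
    (abs_nonneg (localField J τ i))
  nlinarith [sq_abs (localField J τ i)]

lemma le_sum_mul_tanh (hJ : IsFerromagnetic J R) {M : ℝ} (hβ : 0 ≤ β) (hM : β * R ≤ M)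
    (τ : Config N) : 1 / cosh M ^ 2 * (β * fieldSq J τ) ≤
      ∑ i, localField J τ i * tanh (β * localField J τ i) := by
  rw [fieldSq, Finset.mul_sum, Finset.mul_sum]
  refine Finset.sum_le_sum fun i _ => ?_
  have h : |β * localField J τ i| ≤ M := by
    rw [abs_mul, abs_of_nonneg hβ]
    exact (mul_le_mul_of_nonneg_left (abs_localField_le hJ τ i) hβ).trans hM
  simpa using le_mul_tanh_sub (a := 0) hβ (by simpa using (abs_nonneg _).trans h) h

/-- In the high temperature regime the log-partition function is at least of the order of the
squared Frobenius norm. -/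
lemma le_logPartition (hJ : IsFerromagnetic J R) (hβ : 0 < β) :
    (β ^ 2 / (8 * cosh (β * R) ^ 2 * (1 + β * R + β ^ 2 * R ^ 2))) * frobSq J
      ≤ logPartition J β := by
  rcases N.eq_zero_or_pos with rfl | hN
  · simpa [frobSq] using logPartition_nonneg hJ hβ.le
  have hR : 0 ≤ R := (hJ.nonneg ⟨0, hN⟩ ⟨0, hN⟩).trans (entry_le hJ ⟨0, hN⟩ ⟨0, hN⟩)
  set D := 1 + β * R + β ^ 2 * R ^ 2 with hD
  have hD0 : 0 < D := by positivity
  -- `C` bounds `F' = E H / 2` from below on `[β / 2, β]`, where the factor `s` is at least `β / 2`.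
  -- That interval contributes `C β / 2`, and `F (β / 2) ≥ 0` accounts for the rest.
  set C := β / (4 * cosh (β * R) ^ 2 * D) * frobSq J with hC
  have hder : ∀ s ∈ interior (Set.Icc (β / 2) β), C ≤ deriv (logPartition J) s := fun s hs => by
    rw [interior_Icc] at hs
    obtain ⟨hs1, hs2⟩ := hs
    have hs0 : 0 ≤ s := by linarith
    rw [(hasDerivAt_logPartition J s).deriv, expect_hamiltonian hJ]
    have h1 := expect_mono J s (le_sum_mul_tanh hJ hs0
      (mul_le_mul_of_nonneg_right hs2.le hR : s * R ≤ β * R))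
    simp only [expect_const_mul] at h1
    have h2 := le_expect_fieldSq hJ hs0
    have hE : 0 ≤ expect J s (fieldSq J) := expect_nonneg J s (fieldSq_nonneg J)
    have h3 : frobSq J ≤ D * expect J s (fieldSq J) := by
      refine h2.trans (mul_le_mul_of_nonneg_right ?_ hE)
      rw [hD]; gcongr
    have hc : 0 < 1 / cosh (β * R) ^ 2 := by have := cosh_pos (β * R); positivity
    have h4 : frobSq J / D ≤ expect J s (fieldSq J) := by rwa [div_le_iff₀' hD0]
    calc C = 1 / cosh (β * R) ^ 2 * (β / 2 * (frobSq J / D)) / 2 := by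
          rw [hC]; have := (cosh_pos (β * R)).ne'; field_simp; ring
      _ ≤ 1 / cosh (β * R) ^ 2 * (s * expect J s (fieldSq J)) / 2 := by
          have hF : 0 ≤ frobSq J / D := div_nonneg (by unfold frobSq; positivity) hD0.le
          gcongr
      _ ≤ _ := by linarith
  have := (convex_Icc (β / 2) β).mul_sub_le_image_sub_of_le_deriv
    (fun x _ => (hasDerivAt_logPartition J x).continuousAt.continuousWithinAt)
    (fun x _ => (hasDerivAt_logPartition J x).differentiableAt.differentiableWithinAt)
    hder (β / 2) ⟨le_rfl, by linarith⟩ β ⟨by linarith, le_rfl⟩ (by linarith)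
  have h0 := logPartition_nonneg hJ (by linarith : 0 ≤ β / 2)
  calc _ = C * (β - β / 2) := by
        rw [hC]; have := (cosh_pos (β * R)).ne'; field_simp; ring
    _ ≤ _ := by linarith

/-- On `H ≤ x` the density relative to uniform spins is at most `exp (β x / 2 - F)`. With `E`
everything and `F` large, this says that `H` is not small; with `F ≥ 0` alone, it transfers rare
events of uniform spins to the Gibbs measure. -/
lemma prob_hamiltonian_le (J : Matrix (Fin N) (Fin N) ℝ) (hβ : 0 ≤ β) (x : ℝ)
    (E : Set (Config N)) :
    prob J β (E ∩ {τ | hamiltonian J τ ≤ x}) ≤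
      exp (β * x / 2 - logPartition J β) * (E.ncard / 2 ^ N) := by
  classical
  have h : ∀ τ, (E ∩ {τ | hamiltonian J τ ≤ x}).indicator (pmf J β) τ ≤
      if τ ∈ E then 1 / 2 ^ N * exp (β * x / 2 - logPartition J β) else 0 := fun τ => by
    by_cases hE : τ ∈ E
    · rw [if_pos hE]
      by_cases hx : hamiltonian J τ ≤ x
      · rw [Set.indicator_of_mem (show τ ∈ E ∩ {τ | hamiltonian J τ ≤ x} from ⟨hE, hx⟩), pmf]
        have := mul_le_mul_of_nonneg_left hx hβ
        gcongr
        linarith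
      · rw [Set.indicator_of_notMem fun h => hx h.2]; positivity
    · rw [if_neg hE, Set.indicator_of_notMem fun h => hE h.1]
  refine (Finset.sum_le_sum fun τ _ => h τ).trans (le_of_eq ?_)
  rw [← Finset.sum_filter, Finset.sum_const, nsmul_eq_mul, Set.ncard_eq_toFinset_card']
  have : E.toFinset = Finset.univ.filter (· ∈ E) := by ext; simp
  rw [this]; ring

/-- Strong concavity of the log-pseudolikelihood, with modulus of order `fieldSq`: bounded row sums
keep the arguments of `tanh` in `[-M, M]`. -/
lemma le_score_sub (hJ : IsFerromagnetic J R) {a b M : ℝ} (ha : 0 ≤ a) (hab : a ≤ b)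
    (hM : b * R ≤ M) (τ : Config N) :
    1 / cosh M ^ 2 * ((b - a) * fieldSq J τ) ≤ score J a τ - score J b τ := by
  rw [score_eq, score_eq, sub_sub_sub_cancel_left, ← Finset.sum_sub_distrib, fieldSq,
    Finset.mul_sum, Finset.mul_sum]
  refine Finset.sum_le_sum fun i _ => ?_
  have hb := ha.trans hab
  have h : |b * localField J τ i| ≤ M := by
    rw [abs_mul, abs_of_nonneg hb]
    exact (mul_le_mul_of_nonneg_left (abs_localField_le hJ τ i) hb).trans hM
  refine le_mul_tanh_sub hab (le_trans ?_ h) h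
  rw [abs_mul, abs_mul, abs_of_nonneg ha, abs_of_nonneg hb]
  exact mul_le_mul_of_nonneg_right hab (abs_nonneg _)

lemma deviationProb_le {a L K : ℝ} (ha : 0 ≤ a) (h : a * L ≤ K) :
    deviationProb J β a K ≤
      prob J β {τ | ENNReal.ofReal L < (mple J τ - (β : EReal)).abs} := by
  refine prob_mono J β fun τ hτ => ?_
  simp only [Set.mem_ofPred_eq] at hτ ⊢
  by_contra! hle
  refine absurd hτ (not_lt.2 ?_)
  calc _ ≤ ENNReal.ofReal a * ENNReal.ofReal L := by gcongr
    _ = ENNReal.ofReal (a * L) := (ENNReal.ofReal_mul ha).symm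
    _ ≤ _ := ENNReal.ofReal_le_ofReal h

/-- If the log-partition function is at least of order `A` and the second moment of the score at
most of order `A`, then the estimator has rate `√A`, once `A` is large. -/
lemma exists_prob_mple_le (hβ : 0 < β) {C c ε : ℝ} (hC : 0 < C) (hc : 0 < c) (hε : 0 < ε)
    (R : ℝ) :
    ∃ K A₀ : ℝ, 0 < A₀ ∧ ∀ (N : ℕ) (J : Matrix (Fin N) (Fin N) ℝ) (A : ℝ), IsFerromagnetic J R →
      0 ≤ R → A₀ ≤ A → expect J β (fun τ => score J β τ ^ 2) ≤ C * A →
      c * A ≤ logPartition J β →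
      prob J β {τ | ENNReal.ofReal (K / √A) < (mple J τ - (β : EReal)).abs} ≤ ε := by
  -- Chebyshev threshold: `|S| > K₁ √A` has probability at most `ε / 2`.
  set K₁ := √(2 * C / ε) with hK₁
  have hK₁0 : 0 < K₁ := sqrt_pos.2 (by positivity)
  have hK₁2 : K₁ ^ 2 = 2 * C / ε := sq_sqrt (by positivity)
  set κ := 1 / cosh ((β + 1) * R) ^ 2 with hκ
  have hκ0 : 0 < κ := by have := cosh_pos ((β + 1) * R); positivity
  -- With this `δ`, the bound for `H ≤ δ A` has exponent `β δ A / 2 - F ≤ -c A / 2`.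
  set δ := c / β with hδ
  have hδ0 : 0 < δ := by positivity
  -- Since `fieldSq ≥ δ A / (2 β)` on the good event, the score changes by at least `(K₁ + 1) √A`
  -- over the distance `K / √A`.
  set K := 2 * β * (K₁ + 1) / (κ * δ) with hK
  have hK0 : 0 < K := by positivity
  have htend : Tendsto (fun A : ℝ => exp (-(c / 2 * A))) atTop (𝓝 0) :=
    tendsto_exp_neg_atTop_nhds_zero.comp (tendsto_id.const_mul_atTop (by positivity))
  obtain ⟨A₁, hA₁⟩ := eventually_atTop.1 (htend.eventually_le_const (by positivity : 0 < ε / 2))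
  -- The three lower bounds on `A` make the exponential tail small, keep `K / √A ≤ 1` so that `κ`
  -- applies up to `β + 1`, and make `K₁ √A` at most `δ A / 2`.
  refine ⟨K, max (max A₁ (K ^ 2)) ((2 * K₁ / δ) ^ 2), lt_max_of_lt_right (by positivity),
    fun N J A hJ hR hA hS hF => ?_⟩
  have hA1 : A₁ ≤ A := (le_max_left _ _).trans ((le_max_left _ _).trans hA)
  have hA2 : K ^ 2 ≤ A := (le_max_right _ _).trans ((le_max_left _ _).trans hA)
  have hA3 : (2 * K₁ / δ) ^ 2 ≤ A := (le_max_right _ _).trans hA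
  have hA0 : 0 < A := lt_of_lt_of_le (by positivity) hA2
  have hsA : 0 < √A := sqrt_pos.2 hA0
  have hAA : √A * √A = A := mul_self_sqrt hA0.le
  have hKA : K ≤ √A := le_sqrt_of_sq_le hA2
  have hK₁A : 2 * K₁ / δ ≤ √A := le_sqrt_of_sq_le hA3
  have hL1 : K / √A ≤ 1 := (div_le_one hsA).2 hKA
  have hL0 : 0 < K / √A := by positivity
  have hsub : {τ | ENNReal.ofReal (K / √A) < (mple J τ - (β : EReal)).abs} ⊆
      {τ | 2 * C * A / ε < score J β τ ^ 2} ∪ (Set.univ ∩ {τ | hamiltonian J τ ≤ δ * A}) := by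
    intro τ hτ
    by_contra hcon
    simp only [Set.mem_union, Set.mem_ofPred_eq, Set.univ_inter, not_or, not_lt, not_le] at hcon
    obtain ⟨h1, h2⟩ := hcon
    have h3 : |score J β τ| ≤ K₁ * √A := by
      refine abs_le_of_sq_le_sq ?_ (by positivity)
      rw [mul_pow, hK₁2, sq_sqrt hA0.le]
      exact h1.trans (le_of_eq (by ring))
    have h4 : K₁ * √A ≤ δ * A / 2 := by
      rw [div_le_iff₀ hδ0] at hK₁A
      nlinarith
    obtain ⟨h5, h6⟩ := abs_le.1 h3
    have h7 := sum_mul_tanh_le (J := J) hβ.le τ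
    have h8 : δ * A / 2 ≤ β * fieldSq J τ := by
      have := score_eq J β τ; linarith
    have h9 : K₁ * √A < κ * (K / √A * fieldSq J τ) := by
      have e : κ * (K / √A * (δ * A / 2)) = β * ((K₁ + 1) * √A) := by
        rw [hK]; nth_rw 2 [← hAA]; field_simp
      have : β * (κ * (K / √A * fieldSq J τ)) ≥ β * ((K₁ + 1) * √A) := by
        rw [← e]
        have := mul_le_mul_of_nonneg_left h8 (by positivity : 0 ≤ κ * (K / √A))
        linarith
      have := le_of_mul_le_mul_left this hβ
      nlinarith
    refine absurd hτ (not_lt.2 (abs_mple_sub_le hJ hβ.le hL0 ?_ fun hlt => ?_))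
    · have := le_score_sub hJ hβ.le (by linarith : β ≤ β + K / √A)
        (mul_le_mul_of_nonneg_right (by linarith) hR : _ ≤ (β + 1) * R) τ
      rw [add_sub_cancel_left] at this
      linarith
    · have := le_score_sub hJ (by linarith : 0 ≤ β - K / √A) (by linarith : β - K / √A ≤ β)
        (mul_le_mul_of_nonneg_right (by linarith) hR : _ ≤ (β + 1) * R) τ
      rw [sub_sub_cancel] at this
      linarith
  refine (prob_mono J β hsub).trans ((prob_union_le J β _ _).trans ?_)
  have p1 : prob J β {τ | 2 * C * A / ε < score J β τ ^ 2} ≤ ε / 2 := by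
    refine (prob_lt_le J β (fun τ => sq_nonneg _) (by positivity)).trans ?_
    rw [div_le_iff₀ (by positivity)]
    exact hS.trans (le_of_eq (by field_simp))
  have p2 : prob J β (Set.univ ∩ {τ | hamiltonian J τ ≤ δ * A}) ≤ ε / 2 := by
    refine (prob_hamiltonian_le J hβ.le _ _).trans ?_
    have : ((Set.univ : Set (Config N)).ncard : ℝ) / 2 ^ N = 1 := by
      rw [Set.ncard_univ, Nat.card_eq_fintype_card]
      simp
    rw [this, mul_one]
    refine le_trans (exp_le_exp.2 ?_) (hA₁ A hA1)
    have : β * (δ * A) = c * A := by rw [hδ]; field_simp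
    linarith
  linarith

/-! ### Product measures in the Gibbs variational principle. -/

/-- The density of a spin with mean `tanh h`. -/
def tilt (h : ℝ) (s : ℤˣ) : ℝ := exp (h * ((s : ℤ) : ℝ)) / (2 * cosh h)

lemma tilt_add (h : ℝ) : tilt h 1 + tilt h (-1) = 1 := by
  have hc := cosh_pos h
  rw [tilt, tilt, ← add_div, div_eq_one_iff_eq (by positivity),
    cosh_eq]
  push_cast
  ring_nf

lemma tilt_sub (h : ℝ) : tilt h 1 + -tilt h (-1) = tanh h := by
  have hc := cosh_pos h
  rw [tilt, tilt, tanh_eq_sinh_div_cosh, sinh_eq]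
  push_cast
  field_simp
  ring_nf

lemma sum_prod_eq (f : Fin N → ℤˣ → ℝ) : ∑ τ : Config N, ∏ k, f k (τ k) = ∏ k, ∑ s, f k s := by
  rw [Finset.prod_univ_sum, Fintype.piFinset_univ]

lemma sum_prod_tilt (N : ℕ) (h : ℝ) : ∑ τ : Config N, ∏ k, tilt h (τ k) = 1 := by
  rw [sum_prod_eq fun _ => tilt h]
  simp [tilt_add]

lemma sum_prod_tilt_mul_spin (h : ℝ) (i : Fin N) :
    ∑ τ : Config N, (∏ k, tilt h (τ k)) * spin τ i = tanh h := by
  have e : ∀ τ : Config N, (∏ k, tilt h (τ k)) * spin τ i =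
      ∏ k, tilt h (τ k) * (if k = i then ((τ k : ℤ) : ℝ) else 1) := fun τ => by
    rw [Finset.prod_mul_distrib, Finset.prod_ite_eq' _ i]; simp [spin]
  simp only [e]
  rw [sum_prod_eq fun k s => tilt h s * (if k = i then ((s : ℤ) : ℝ) else 1)]
  rw [Finset.prod_eq_single i]
  · simp [tilt_sub]
  · intro k _ hk; simp [hk, tilt_add]
  · simp

lemma sum_prod_tilt_mul_spin_mul_spin (h : ℝ) {i j : Fin N} (hij : i ≠ j) :
    ∑ τ : Config N, (∏ k, tilt h (τ k)) * (spin τ i * spin τ j) = tanh h ^ 2 := by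
  have e : ∀ τ : Config N, (∏ k, tilt h (τ k)) * (spin τ i * spin τ j) =
      ∏ k, tilt h (τ k) * ((if k = i then ((τ k : ℤ) : ℝ) else 1) *
        (if k = j then ((τ k : ℤ) : ℝ) else 1)) := fun τ => by
    rw [Finset.prod_mul_distrib, Finset.prod_mul_distrib, Finset.prod_ite_eq' _ i,
      Finset.prod_ite_eq' _ j]
    simp [spin]
  simp only [e]
  rw [sum_prod_eq fun k s => tilt h s * ((if k = i then ((s : ℤ) : ℝ) else 1) *
    (if k = j then ((s : ℤ) : ℝ) else 1))]
  rw [← Finset.prod_subset (Finset.subset_univ {i, j}), Finset.prod_pair hij]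
  · simp [hij, hij.symm, tilt_sub, pow_two]
  · intro k _ hk
    simp only [Finset.mem_insert, Finset.mem_singleton, not_or] at hk
    simp [hk.1, hk.2, tilt_add]

/-- The Gibbs variational lower bound for product measures. -/
lemma tilt_le_logPartition (hJ : IsFerromagnetic J R) (b h : ℝ) :
    b / 2 * tanh h ^ 2 * ∑ i, ∑ j, J i j - N * (h * tanh h - log (cosh h))
      ≤ logPartition J b := by
  set w : Config N → ℝ := fun τ => ∏ k, tilt h (τ k) with hw
  have hc := cosh_pos h
  have hw0 : ∀ τ, 0 ≤ w τ := fun τ => Finset.prod_nonneg fun k _ => by unfold tilt; positivity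
  -- `x` is the logarithm of the unnormalized Gibbs weight relative to the product weight `w`;
  -- Jensen's inequality for `exp` then bounds the partition function below.
  set x : Config N → ℝ := fun τ => 1 / 2 * b * hamiltonian J τ - h * ∑ i, spin τ i
    + N * log (cosh h) with hx
  have hwx : ∀ τ, w τ * exp (x τ) = 1 / 2 ^ N * exp (1 / 2 * b * hamiltonian J τ) := fun τ => by
    have e1 : w τ = exp (h * ∑ i, spin τ i) / (2 ^ N * cosh h ^ N) := by
      simp only [hw, tilt, Finset.prod_div_distrib, ← exp_sum, Finset.mul_sum, spin,
        Finset.prod_const, Finset.card_univ, Fintype.card_fin, mul_pow]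
    have e2 : exp (N * log (cosh h)) = cosh h ^ N := by
      rw [exp_nat_mul, exp_log hc]
    rw [e1, hx]
    simp only [exp_add, exp_sub, e2]
    have := exp_pos (h * ∑ i, spin τ i)
    field_simp
  have hjensen := convexOn_exp.map_sum_le (t := Finset.univ) (w := w) (p := x)
    (fun τ _ => hw0 τ) (sum_prod_tilt N h) (fun _ _ => Set.mem_univ _)
  simp only [smul_eq_mul, hwx, ← Finset.mul_sum] at hjensen
  have hlog : ∑ τ, w τ * x τ ≤ logPartition J b :=
    (le_log_iff_exp_le (partition_pos J b)).2 hjensen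
  refine le_trans (le_of_eq ?_) hlog
  have s1 : ∑ τ, w τ * hamiltonian J τ = tanh h ^ 2 * ∑ i, ∑ j, J i j := by
    simp only [hamiltonian, Finset.mul_sum]
    rw [Finset.sum_comm]
    refine Finset.sum_congr rfl fun i _ => ?_
    rw [Finset.sum_comm]
    refine Finset.sum_congr rfl fun j _ => ?_
    by_cases hij : i = j
    · subst hij; simp [hJ.diag]
    · rw [← sum_prod_tilt_mul_spin_mul_spin h hij, Finset.sum_mul]
      exact Finset.sum_congr rfl fun τ _ => by ring
  have s2 : ∑ τ, w τ * ∑ i, spin τ i = N * tanh h := by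
    simp only [Finset.mul_sum]
    rw [Finset.sum_comm]
    simp [hw, sum_prod_tilt_mul_spin]
  have s3 : ∑ τ, w τ = 1 := sum_prod_tilt N h
  have : ∑ τ, w τ * x τ = 1 / 2 * b * ∑ τ, w τ * hamiltonian J τ
      - h * ∑ τ, w τ * ∑ i, spin τ i + N * log (cosh h) * ∑ τ, w τ := by
    rw [Finset.mul_sum, Finset.mul_sum, Finset.mul_sum, ← Finset.sum_sub_distrib,
      ← Finset.sum_add_distrib]
    exact Finset.sum_congr rfl fun τ _ => by simp only [hx]; ring
  rw [this, s1, s2, s3]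
  ring

/-- The function vanishes at `0` and has derivative `(b tanh x - x) / cosh² x`. If `cosh² h < b`,
then `tanh x ≥ x / cosh² h > x / b` on `(0, h)`, so it increases there. -/
lemma exists_tilt_pos {b : ℝ} (hb : 1 < b) :
    ∃ h : ℝ, 0 < b / 2 * tanh h ^ 2 - h * tanh h + log (cosh h) := by
  have hcont : Tendsto (fun h => cosh h ^ 2) (𝓝[>] 0) (𝓝 1) := by
    have : Continuous fun h => cosh h ^ 2 := by fun_prop
    simpa using (this.tendsto 0).mono_left nhdsWithin_le_nhds
  obtain ⟨h, hh, hpos⟩ := ((hcont.eventually_lt_const hb).and self_mem_nhdsWithin).exists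
  have hpos : 0 < h := hpos
  refine ⟨h, ?_⟩
  set g := fun h => b / 2 * tanh h ^ 2 - h * tanh h + log (cosh h) with hg
  have hd : ∀ x, HasDerivAt g (1 / cosh x ^ 2 * (b * tanh x - x)) x := fun x => by
    have h1 := hasDerivAt_tanh x
    have h2 := (hasDerivAt_cosh x).log (cosh_pos x).ne'
    refine ((((h1.pow 2).const_mul (b / 2)).sub ((hasDerivAt_id x).mul h1)).add h2).congr_deriv ?_
    rw [← tanh_eq_sinh_div_cosh]
    simp
    ring
  have hmono : StrictMonoOn g (Set.Icc 0 h) := by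
    refine strictMonoOn_of_deriv_pos (convex_Icc 0 h)
      (fun x _ => (hd x).continuousAt.continuousWithinAt) fun x hx => ?_
    rw [interior_Icc] at hx
    rw [(hd x).deriv]
    have hc := cosh_pos x
    have hch := cosh_pos h
    have := le_tanh_sub_tanh (M := h) (by linarith) hx.2.le hx.1.le
    rw [tanh_zero, sub_zero, sub_zero, one_div, inv_mul_le_iff₀ (by positivity)] at this
    have ht : 0 < tanh x := by
      by_contra! hle
      have := mul_nonneg (sq_nonneg (cosh h)) (neg_nonneg.2 hle)
      linarith [hx.1]
    refine mul_pos (by positivity) ?_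
    nlinarith
  have := hmono ⟨le_rfl, hpos.le⟩ ⟨hpos.le, le_rfl⟩ hpos
  simpa [hg] using this

end Ising
end

/-! ### Littlewood–Offord anticoncentration and the dense regime. -/

noncomputable section

/-- The ratio of the two sides is monotone in `n` because `(2n + 1)(2n + 3) ≤ (2n + 2)²`. -/
lemma Nat.centralBinom_sq_mul_le (n : ℕ) : n.centralBinom ^ 2 * (2 * n + 1) ≤ 16 ^ n := by
  induction n with
  | zero => simp
  | succ n ih =>
    have h := Nat.succ_mul_centralBinom_succ n
    have h2 : (n + 1) ^ 2 * ((n + 1).centralBinom ^ 2 * (2 * (n + 1) + 1))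
        = 4 * (2 * n + 1) * (2 * n + 3) * (n.centralBinom ^ 2 * (2 * n + 1)) := by
      calc _ = ((n + 1) * (n + 1).centralBinom) ^ 2 * (2 * n + 3) := by ring
        _ = _ := by rw [h]; ring
    have h3 : 4 * (2 * n + 1) * (2 * n + 3) ≤ 16 * (n + 1) ^ 2 := by nlinarith
    refine le_of_mul_le_mul_left (a := (n + 1) ^ 2) ?_ (by positivity)
    rw [h2]
    calc _ ≤ 16 * (n + 1) ^ 2 * 16 ^ n := Nat.mul_le_mul h3 ih
      _ = _ := by ring

lemma Nat.choose_half_sq_mul_le (n : ℕ) : n.choose (n / 2) ^ 2 * n ≤ 4 ^ n := by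
  rcases Nat.even_or_odd' n with ⟨k, rfl | rfl⟩
  · have h := Nat.centralBinom_sq_mul_le k
    rw [Nat.mul_div_cancel_left k two_pos, ← Nat.centralBinom_eq_two_mul_choose, pow_mul]
    norm_num
    nlinarith [sq_nonneg k.centralBinom]
  · have h := Nat.centralBinom_sq_mul_le (k + 1)
    have e : (2 * k + 1) / 2 = k := by omega
    have e2 : (k + 1).centralBinom = 2 * (2 * k + 1).choose k := by
      rw [Nat.centralBinom_eq_two_mul_choose, show 2 * (k + 1) = 2 * k + 1 + 1 by ring,
        Nat.choose_succ_succ, Nat.choose_symm_half]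
      ring
    rw [e2] at h
    rw [e]
    have e3 : 4 ^ (2 * k + 1) * 4 = 16 ^ (k + 1) := by
      rw [← pow_succ, show 2 * k + 1 + 1 = 2 * (k + 1) by ring, pow_mul]; norm_num
    nlinarith [sq_nonneg ((2 * k + 1).choose k)]

namespace Ising

open Real

variable {N : ℕ} {J : Matrix (Fin N) (Fin N) ℝ} {R β : ℝ}

lemma spin_injective : Function.Injective (spin : Config N → Fin N → ℝ) := fun τ τ' h => by
  funext i
  have := congrFun h i
  simp only [spin] at this
  exact Units.ext (by exact_mod_cast this)

open Classical in
/-- The Littlewood–Offord bound for a unit interval. -/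
lemma ncard_sum_mul_spin_mem_le {c : Fin N → ℝ} (hc : ∀ j, 1 / 2 ≤ c j) (x : ℝ) :
    {τ : Config N | x ≤ ∑ j, c j * spin τ j ∧ ∑ j, c j * spin τ j < x + 1}.ncard
      ≤ N.choose (N / 2) := by
  set E := {τ : Config N | x ≤ ∑ j, c j * spin τ j ∧ ∑ j, c j * spin τ j < x + 1} with hE
  set φ : Config N → Finset (Fin N) := fun τ => Finset.univ.filter fun j => spin τ j = 1 with hφ
  have hspin : ∀ τ j, spin τ j = if j ∈ φ τ then 1 else -1 := fun τ j => by
    rcases spin_eq_one_or τ j with h | h <;> norm_num [hφ, h]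
  have hinj : Function.Injective φ := fun τ τ' h => spin_injective <| by
    funext j; rw [hspin, hspin, h]
  -- Raising one spin raises the sum by `2 c_j ≥ 1`, the length of the half-open window. Hence no
  -- set of plus spins contains another, and Sperner's theorem applies.
  have hanti : IsAntichain (· ⊆ ·) ((E.toFinset.image φ : Finset (Finset (Fin N))) :
      Set (Finset (Fin N))) := by
    intro A hA B hB hne hsub
    simp only [Finset.coe_image, Set.coe_toFinset, Set.mem_image] at hA hB
    obtain ⟨τ, hτ, rfl⟩ := hA
    obtain ⟨τ', hτ', rfl⟩ := hB
    obtain ⟨k, hk', hk⟩ := Finset.exists_of_ssubset (hsub.ssubset_of_ne hne)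
    have : 1 ≤ ∑ j, (c j * spin τ' j - c j * spin τ j) := by
      have hk1 : 1 ≤ c k * spin τ' k - c k * spin τ k := by
        rw [hspin, hspin, if_pos hk', if_neg hk]; linarith [hc k]
      refine hk1.trans (Finset.single_le_sum (f := fun j => c j * spin τ' j - c j * spin τ j)
        (fun j _ => ?_) (Finset.mem_univ k))
      have := hc j
      simp only [hspin]
      by_cases h1 : j ∈ φ τ
      · rw [if_pos h1, if_pos (hsub h1)]; simp
      · rw [if_neg h1]; split_ifs <;> linarith
    rw [Finset.sum_sub_distrib] at this
    linarith [hτ.1, hτ'.2]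
  have := hanti.sperner
  rwa [Finset.card_image_of_injective _ hinj, Fintype.card_fin, ← Set.ncard_eq_toFinset_card']
    at this

/-- The interval `[-y, y]` is covered by `⌊2 y⌋ + 1` half-open unit windows. -/
lemma ncard_abs_sum_mul_spin_le {c : Fin N → ℝ} (hc : ∀ j, 1 / 2 ≤ c j) {y : ℝ} (hy : 0 ≤ y) :
    ({τ : Config N | |∑ j, c j * spin τ j| ≤ y}.ncard : ℝ)
      ≤ (2 * y + 1) * N.choose (N / 2) := by
  have hsub : {τ : Config N | |∑ j, c j * spin τ j| ≤ y} ⊆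
      ⋃ l ∈ Finset.range (⌊2 * y⌋₊ + 1), {τ : Config N | -y + l ≤ ∑ j, c j * spin τ j ∧
        ∑ j, c j * spin τ j < -y + l + 1} := fun τ hτ => by
    obtain ⟨h1, h2⟩ := abs_le.1 (show |∑ j, c j * spin τ j| ≤ y from hτ)
    simp only [Set.mem_iUnion, Finset.mem_range]
    refine ⟨⌊∑ j, c j * spin τ j + y⌋₊, Nat.lt_succ_of_le (Nat.floor_le_floor (by linarith)),
      ?_, ?_⟩
    · have := Nat.floor_le (by linarith : 0 ≤ ∑ j, c j * spin τ j + y); linarith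
    · have := Nat.lt_floor_add_one (∑ j, c j * spin τ j + y); linarith
  have h1 := (Set.ncard_le_ncard hsub (Set.toFinite _)).trans
    (Finset.set_ncard_biUnion_le (Finset.range (⌊2 * y⌋₊ + 1)) _)
  have h2 := h1.trans (Finset.sum_le_card_nsmul _ _ _ fun l _ =>
    ncard_sum_mul_spin_mem_le hc (-y + l))
  rw [Finset.card_range, smul_eq_mul] at h2
  have h3 : ((⌊2 * y⌋₊ + 1 : ℕ) : ℝ) ≤ 2 * y + 1 := by
    push_cast; linarith [Nat.floor_le (by linarith : 0 ≤ 2 * y)]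
  calc _ ≤ (((⌊2 * y⌋₊ + 1) * N.choose (N / 2) : ℕ) : ℝ) := by exact_mod_cast h2
    _ ≤ _ := by
      rw [Nat.cast_mul]; exact mul_le_mul_of_nonneg_right h3 (by positivity)

lemma choose_half_div_le (hN : 0 < N) : (N.choose (N / 2) : ℝ) / 2 ^ N ≤ 1 / √N := by
  have h : ((N.choose (N / 2) : ℝ)) ^ 2 * N ≤ 4 ^ N := by
    exact_mod_cast Nat.choose_half_sq_mul_le N
  have hN' : (0 : ℝ) < N := by exact_mod_cast hN
  rw [div_le_div_iff₀ (by positivity) (sqrt_pos.2 hN'), one_mul]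
  refine abs_le_of_sq_le_sq' ?_ (by positivity) |>.2
  rw [mul_pow, sq_sqrt hN'.le, ← pow_mul, mul_comm N 2, pow_mul]
  norm_num [h]

lemma sum_localField (J : Matrix (Fin N) (Fin N) ℝ) (τ : Config N) :
    ∑ i, localField J τ i = ∑ j, (∑ i, J i j) * spin τ j := by
  simp only [localField, Finset.sum_mul]
  exact Finset.sum_comm

/-- If the sum of the local fields is of order `√N` and the sum of their squares is bounded, then
the score decreases at a fixed rate. -/
lemma le_score_sub_of_sum {a b s M : ℝ} {τ : Config N} (ha : 0 ≤ a) (hab : a ≤ b)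
    (hN : 0 < N) (hM : fieldSq J τ ≤ M) (hs : 0 ≤ s) (hbM : 2 * b * M ≤ s * √N)
    (hsum : s * √N < |∑ i, localField J τ i|) :
    1 / cosh 1 ^ 2 * ((b - a) * (s ^ 2 / 4)) ≤ score J a τ - score J b τ := by
  classical
  have hb := ha.trans hab
  set m := localField J τ with hm
  -- Restricting to `|b m_i| ≤ 1` makes the slope constant independent of `b`, hence of the distance
  -- `L` later chosen in terms of it. The discarded fields satisfy `|m_i| ≤ b m_i²`, so they remove
  -- at most half of the sum.
  set S := Finset.univ.filter fun i => |b * m i| ≤ 1 with hS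
  set Sc := Finset.univ.filter fun i => ¬ |b * m i| ≤ 1 with hSc
  have hbig : ∑ i ∈ Sc, |m i| ≤ b * M := by
    calc _ ≤ ∑ i ∈ Sc, b * m i ^ 2 := by
          refine Finset.sum_le_sum fun i hi => ?_
          have h1 : 1 < b * |m i| := by
            simpa [hSc, abs_mul, abs_of_nonneg hb] using hi
          rw [← sq_abs]
          nlinarith [abs_nonneg (m i)]
      _ ≤ ∑ i, b * m i ^ 2 := Finset.sum_le_sum_of_subset_of_nonneg (Finset.subset_univ _)
          fun i _ _ => by positivity
      _ ≤ b * M := by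
          rw [← Finset.mul_sum]; exact mul_le_mul_of_nonneg_left hM hb
  have hsplit : ∑ i ∈ S, m i + ∑ i ∈ Sc, m i = ∑ i, m i :=
    Finset.sum_filter_add_sum_filter_not _ _ _
  have hsmall : s * √N / 2 ≤ |∑ i ∈ S, m i| := by
    rw [← hsplit] at hsum
    have h1 := abs_add_le (∑ i ∈ S, m i) (∑ i ∈ Sc, m i)
    have h2 := Finset.abs_sum_le_sum_abs m Sc
    linarith
  have hN' : (0 : ℝ) < N := by exact_mod_cast hN
  have hsq : s ^ 2 / 4 ≤ ∑ i ∈ S, m i ^ 2 := by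
    have h1 := sq_sum_le_card_mul_sum_sq (s := S) (f := m)
    have h2 : (S.card : ℝ) ≤ N := by
      have := Finset.card_le_univ S; rw [Fintype.card_fin] at this; exact_mod_cast this
    have h3 : (s * √N / 2) ^ 2 ≤ (∑ i ∈ S, m i) ^ 2 := by
      rw [← sq_abs (∑ i ∈ S, m i)]; exact pow_le_pow_left₀ (by positivity) hsmall 2
    have h4 : (S.card : ℝ) * ∑ i ∈ S, m i ^ 2 ≤ N * ∑ i ∈ S, m i ^ 2 :=
      mul_le_mul_of_nonneg_right h2 (Finset.sum_nonneg fun _ _ => sq_nonneg _)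
    have h5 : (s * √N / 2) ^ 2 = N * (s ^ 2 / 4) := by
      rw [div_pow, mul_pow, sq_sqrt hN'.le]; ring
    refine le_of_mul_le_mul_left ?_ hN'
    linarith
  have hc : 0 ≤ 1 / cosh 1 ^ 2 := by positivity
  rw [score_eq, score_eq, sub_sub_sub_cancel_left, ← Finset.sum_sub_distrib]
  calc _ ≤ 1 / cosh 1 ^ 2 * ((b - a) * ∑ i ∈ S, m i ^ 2) :=
        mul_le_mul_of_nonneg_left (mul_le_mul_of_nonneg_left hsq (by linarith)) hc
    _ ≤ ∑ i ∈ S, (m i * tanh (b * m i) - m i * tanh (a * m i)) := by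
        rw [Finset.mul_sum, Finset.mul_sum]
        refine Finset.sum_le_sum fun i hi => ?_
        have h1 : |b * m i| ≤ 1 := (Finset.mem_filter.1 hi).2
        refine le_mul_tanh_sub hab (le_trans ?_ h1) h1
        rw [abs_mul, abs_mul, abs_of_nonneg ha, abs_of_nonneg hb]
        exact mul_le_mul_of_nonneg_right hab (abs_nonneg _)
    _ ≤ _ := Finset.sum_le_sum_of_subset_of_nonneg (Finset.subset_univ _) fun i _ _ =>
        sub_nonneg.2 (mul_tanh_mono hab _)

/-- At high temperature and bounded Frobenius norm, the estimator is tight. -/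
lemma exists_prob_mple_le_of_frobSq_le (hβ : 0 < β) (hR : 0 ≤ R) (hβR : β * R < 1) {T ε : ℝ}
    (hT : 0 < T) (hε : 0 < ε) :
    ∃ (L : ℝ) (N₀ : ℕ), 0 < L ∧ ∀ N ≥ N₀, ∀ J : Matrix (Fin N) (Fin N) ℝ,
      IsFerromagnetic J R → frobSq J ≤ T → (∀ j, 1 / 2 ≤ ∑ i, J i j) →
      prob J β {τ | ENNReal.ofReal L < (mple J τ - (β : EReal)).abs} ≤ ε := by
  have h1R : 0 < 1 - β * R := by linarith
  set B := T / (1 - β * R) with hB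
  have hB0 : 0 < B := by positivity
  set C := (4 + 4 * β * R) * B + 4 * β * R * T with hC
  have hC0 : 0 < C := by positivity
  set M := 4 * B / ε with hM
  have hM0 : 0 < M := by positivity
  set K := √(4 * C / ε) with hK
  have hK0 : 0 ≤ K := sqrt_nonneg _
  have hK2 : K ^ 2 = 4 * C / ε := sq_sqrt (by positivity)
  -- This bounds `H ≤ S + β fieldSq` on the good event.
  set X := K + β * M with hX
  -- The density bound `exp (β X / 2)` times the Littlewood–Offord probability `4 s` equals `ε / 2`.
  set s := ε / (8 * exp (β * X / 2)) with hs
  have hs0 : 0 < s := by positivity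
  set κ := 1 / cosh 1 ^ 2 with hκ
  have hκ0 : 0 < κ := by have := cosh_pos 1; positivity
  -- The first term makes the score fall by at least `K + 1`. The summand `β` gives `L > β`, which
  -- voids the condition on the left of `β`.
  set L := 4 * (K + 1) / (κ * s ^ 2) + β with hL
  have hLβ : β < L := lt_add_of_pos_left _ (by positivity)
  have hsqrt : Tendsto (fun n : ℕ => √(n : ℝ)) atTop atTop :=
    tendsto_sqrt_atTop.comp tendsto_natCast_atTop_atTop
  obtain ⟨N₀, hN₀⟩ := eventually_atTop.1 ((hsqrt.eventually_ge_atTop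
    (2 * (β + L) * M / s)).and ((hsqrt.eventually_ge_atTop (1 / (2 * s))).and
      (eventually_gt_atTop 0)))
  refine ⟨L, N₀, by linarith, fun N hN J hJ hfrob hcol => ?_⟩
  obtain ⟨hN1, hN2, hNpos⟩ := hN₀ N hN
  have hsN : 0 < √(N : ℝ) := sqrt_pos.2 (by exact_mod_cast hNpos)
  have hm : expect J β (fieldSq J) ≤ B := by
    rw [hB, le_div_iff₀' h1R]
    exact (expect_fieldSq_le hJ hβ.le).trans hfrob
  have hS : expect J β (fun τ => score J β τ ^ 2) ≤ C := by
    refine (expect_score_sq_le hJ hβ.le).trans ?_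
    rw [hC]; gcongr
  have hsub : {τ | ENNReal.ofReal L < (mple J τ - (β : EReal)).abs} ⊆
      ({τ | K ^ 2 < score J β τ ^ 2} ∪ {τ | M < fieldSq J τ}) ∪
      ({τ | |∑ j, (∑ i, J i j) * spin τ j| ≤ s * √N} ∩ {τ | hamiltonian J τ ≤ X}) := by
    intro τ hτ
    by_contra hcon
    simp only [Set.mem_union, Set.mem_ofPred_eq, Set.mem_inter_iff, not_or, not_lt, not_and,
      not_le] at hcon
    obtain ⟨⟨h1, h2⟩, h3⟩ := hcon
    have h4 : |score J β τ| ≤ K := abs_le_of_sq_le_sq h1 hK0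
    have h5 : hamiltonian J τ ≤ X := by
      have e := score_eq J β τ
      have e2 := sum_mul_tanh_le (J := J) hβ.le τ
      have e3 := mul_le_mul_of_nonneg_left h2 hβ.le
      have := (abs_le.1 h4).2
      rw [hX]; linarith
    have h6 : s * √N < |∑ i, localField J τ i| := by
      rw [sum_localField]
      by_contra! hle
      exact absurd h5 (not_le.2 (h3 hle))
    have h7 := le_score_sub_of_sum hβ.le (by linarith : β ≤ β + L) hNpos h2 hs0.le
      (by rwa [div_le_iff₀' hs0] at hN1) h6
    refine absurd hτ (not_lt.2 (abs_mple_sub_le hJ hβ.le (by linarith) ?_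
      fun hlt => absurd hlt (by linarith)))
    have h8 : K + 1 ≤ κ * ((β + L - β) * (s ^ 2 / 4)) := by
      have e : κ * (4 * (K + 1) / (κ * s ^ 2) * (s ^ 2 / 4)) = K + 1 := by field_simp
      rw [← e, add_sub_cancel_left, hL]
      gcongr
      linarith
    have := (abs_le.1 h4).2
    linarith
  refine (prob_mono J β hsub).trans ((prob_union_le J β _ _).trans
    (add_le_add_left (prob_union_le J β _ _) _ |>.trans ?_))
  have p1 : prob J β {τ | K ^ 2 < score J β τ ^ 2} ≤ ε / 4 := by
    rw [hK2]
    refine (prob_lt_le J β (fun τ => sq_nonneg _) (by positivity)).trans ?_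
    rw [div_le_iff₀ (by positivity)]
    exact hS.trans (le_of_eq (by field_simp))
  have p2 : prob J β {τ | M < fieldSq J τ} ≤ ε / 4 := by
    refine (prob_lt_le J β (fieldSq_nonneg J) hM0).trans ?_
    rw [div_le_iff₀ hM0]
    exact hm.trans (le_of_eq (by rw [hM]; field_simp))
  have p3 : prob J β ({τ | |∑ j, (∑ i, J i j) * spin τ j| ≤ s * √N} ∩
      {τ | hamiltonian J τ ≤ X}) ≤ ε / 2 := by
    refine (prob_hamiltonian_le J hβ.le _ _).trans ?_
    have hF := logPartition_nonneg hJ hβ.le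
    have hcount := ncard_abs_sum_mul_spin_le hcol (by positivity : 0 ≤ s * √N)
    have h1 : ({τ : Config N | |∑ j, (∑ i, J i j) * spin τ j| ≤ s * √N}.ncard : ℝ) / 2 ^ N
        ≤ 4 * s := by
      calc _ ≤ (2 * (s * √N) + 1) * N.choose (N / 2) / 2 ^ N := by gcongr
        _ = (2 * (s * √N) + 1) * (N.choose (N / 2) / 2 ^ N) := by ring
        _ ≤ (2 * (s * √N) + 1) * (1 / √N) := by
            exact mul_le_mul_of_nonneg_left (choose_half_div_le hNpos) (by positivity)
        _ ≤ 4 * s := by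
            rw [mul_one_div, div_le_iff₀ hsN]
            rw [div_le_iff₀ (by positivity)] at hN2
            linarith
    calc _ ≤ exp (β * X / 2) * (4 * s) := by
          gcongr
          linarith
      _ = ε / 2 := by rw [hs]; field_simp; ring
  linarith

end Ising
end

/-! ### Degree concentration in the binomial random graph. -/

noncomputable section

namespace SimpleGraph

open ProbabilityTheory unitInterval Measure

open Classical in
/-- The degree of the vertex `i`, as a sum of indicators. -/
def degreeSum {V : Type*} [Fintype V] (i : V) (G : SimpleGraph V) : ℝ :=
  ∑ j, if G.Adj i j then 1 else 0

/-- The law of a potential edge in the binomial random graph. -/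
abbrev edgeLaw {V : Type*} (p : I) (e : Sym2 V) : Measure Prop :=
  toNNReal p • dirac (e ∈ (Sym2.diagSetᶜ : Set (Sym2 V))) + toNNReal (σ p) • dirac False

lemma binomialRandom_eq_map_infinitePi {V : Type*} [Countable V] (p : I) :
    binomialRandom V p = (infinitePi (edgeLaw (V := V) p)).map
      (fun ω => fromEdgeSet {e | ω e}) := by
  rw [binomialRandom_eq_map, setBernoulli_eq_map, Measure.map_map (by fun_prop)]
  · rfl
  · exact measurable_set_iff.2 fun e => by simpa using measurable_pi_apply e

open Classical in
lemma mgf_degreeSum {N : ℕ} (i : Fin N) (p : I) (t : ℝ) :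
    mgf (degreeSum i) (binomialRandom (Fin N) p) t
      = (1 + p * (Real.exp t - 1)) ^ (N - 1) := by
  set Φ : (Sym2 (Fin N) → Prop) → SimpleGraph (Fin N) := fun ω => fromEdgeSet {e | ω e} with hΦ
  have hΦm : Measurable Φ := measurable_fromEdgeSet.comp
    (measurable_set_iff.2 fun e => by simpa using measurable_pi_apply e)
  have hdeg : Measurable (degreeSum (V := Fin N) i) := by
    refine Finset.measurable_sum _ fun j _ => ?_
    refine Measurable.ite ?_ measurable_const measurable_const
    have : Measurable fun G : SimpleGraph (Fin N) => G.Adj i j := by fun_prop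
    exact measurableSet_setOfPred.2 this
  rw [binomialRandom_eq_map_infinitePi, mgf_map hΦm.aemeasurable
    (by fun_prop)]
  set u : Fin N → Prop → ℝ := fun j q => if q ∧ i ≠ j then 1 else 0 with hu
  set X : Fin N → (Sym2 (Fin N) → Prop) → ℝ := fun j ω => u j (ω s(i, j)) with hX
  have hXm : ∀ j, Measurable (X j) := fun j =>
    (measurable_from_top (f := u j)).comp (measurable_pi_apply _)
  have hsum : degreeSum i ∘ Φ = ∑ j, X j := by
    funext ω
    simp [degreeSum, hX, hΦ, hu]
  have hind : iIndepFun X (infinitePi (edgeLaw (V := Fin N) p)) := by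
    have h1 := iIndepFun_infinitePi (P := edgeLaw (V := Fin N) p) (X := fun e ω => ω)
      (fun e => by fun_prop)
    have h2 := h1.precomp (g := fun j : Fin N => s(i, j)) fun j k h => Sym2.congr_right.1 h
    exact h2.comp u fun j => measurable_from_top
  rw [hsum, hind.mgf_sum hXm]
  have hone : ∀ j, mgf (X j) (infinitePi (edgeLaw (V := Fin N) p)) t
      = if i = j then 1 else 1 + p * (Real.exp t - 1) := fun j => by
    have : mgf (X j) (infinitePi (edgeLaw (V := Fin N) p)) t = mgf (u j) (edgeLaw p s(i, j)) t := by
      have hm := mgf_map (μ := infinitePi (edgeLaw (V := Fin N) p)) (X := u j) (t := t)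
        (Y := fun ω : Sym2 (Fin N) → Prop => ω s(i, j)) (measurable_pi_apply _).aemeasurable
        (measurable_from_top (f := fun q => Real.exp (t * u j q))).aestronglyMeasurable
      rw [infinitePi_map_eval] at hm
      exact hm.symm
    rw [this, mgf, edgeLaw, integral_add_measure, integral_smul_nnreal_measure,
      integral_smul_nnreal_measure, integral_dirac, integral_dirac]
    · by_cases hij : i = j
      · simp [hu, hij, NNReal.smul_def]
      · simp [hu, hij, NNReal.smul_def]
        ring
    · exact (integrable_dirac (by simp)).smul_measure_nnreal
    · exact (integrable_dirac (by simp)).smul_measure_nnreal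
  simp only [hone]
  rw [Finset.prod_ite, Finset.prod_const_one, one_mul, Finset.prod_const]
  congr 1
  have : Finset.univ.filter (fun x => ¬ i = x) = Finset.univ.erase i := by ext; simp [eq_comm]
  rw [this, Finset.card_erase_of_mem (Finset.mem_univ _), Finset.card_univ, Fintype.card_fin]

/-- Here `exp t - 1 ≤ t + t²` for `|t| ≤ 1`. The `+ 1` in the exponent pays for replacing `N - 1` by
`N`, since `-p (exp t - 1) ≤ p ≤ 1`. -/
lemma mgf_degreeSum_le {N : ℕ} (i : Fin N) (p : I) {t : ℝ} (ht : |t| ≤ 1) :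
    mgf (degreeSum i) (binomialRandom (Fin N) p) t
      ≤ Real.exp (N * p * (t + t ^ 2) + 1) := by
  have hN : 0 < N := i.pos
  have h1 := (abs_le.1 (Real.abs_exp_sub_one_sub_id_le ht)).2
  have hp0 := p.2.1
  have hp1 := p.2.2
  have hpos := Real.exp_pos t
  rw [mgf_degreeSum]
  calc _ ≤ Real.exp (p * (Real.exp t - 1)) ^ (N - 1) := by
        refine pow_le_pow_left₀ ?_ ?_ _
        · nlinarith
        · linarith [Real.add_one_le_exp ((p : ℝ) * (Real.exp t - 1))]
    _ = Real.exp ((N - 1) * (p * (Real.exp t - 1))) := by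
        rw [← Real.exp_nat_mul, Nat.cast_pred hN]
    _ ≤ _ := by
        refine Real.exp_le_exp.2 ?_
        have h2 : (N * p : ℝ) * (Real.exp t - 1) ≤ N * p * (t + t ^ 2) :=
          mul_le_mul_of_nonneg_left (by linarith) (by positivity)
        nlinarith

/-- A Chernoff bound for the degrees of the binomial random graph. -/
lemma measureReal_degreeSum_le {N : ℕ} (i : Fin N) (p : I) {δ : ℝ} (h0 : 0 < δ) (h1 : δ ≤ 1) :
    (binomialRandom (Fin N) p).real {G | δ * (N * p) < |degreeSum i G - N * p|}
      ≤ 2 * Real.exp (1 - N * p * (δ ^ 2 / 4)) := by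
  set μ := binomialRandom (Fin N) p
  -- Without integrability `mgf` would take the default value `0`, against the positive closed form.
  have hint : ∀ t, Integrable (fun G => Real.exp (t * degreeSum i G)) μ := fun t => by
    by_contra hni
    have h := mgf_undef hni
    rw [mgf_degreeSum] at h
    have : 0 < 1 + (p : ℝ) * (Real.exp t - 1) := by
      rcases p.2.1.eq_or_lt with h0 | h0
      · rw [← h0]; simp
      · have := mul_pos h0 (Real.exp_pos t); linarith [p.2.2]
    exact absurd h (pow_pos this _).ne'
  -- The choice `t = ± δ / 2` minimizes `-δ |t| + t²`.
  have hup := measure_ge_le_exp_mul_mgf (X := degreeSum i) (μ := μ) ((1 + δ) * (N * p))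
    (by linarith : 0 ≤ δ / 2) (hint _)
  have hlo := measure_le_le_exp_mul_mgf (X := degreeSum i) (μ := μ) ((1 - δ) * (N * p))
    (by linarith : -(δ / 2) ≤ 0) (hint _)
  have hup2 := hup.trans (mul_le_mul_of_nonneg_left (mgf_degreeSum_le i p
    (by rw [abs_of_nonneg] <;> linarith : |δ / 2| ≤ 1)) (Real.exp_pos _).le)
  have hlo2 := hlo.trans (mul_le_mul_of_nonneg_left (mgf_degreeSum_le i p
    (by rw [abs_neg, abs_of_nonneg] <;> linarith : |-(δ / 2)| ≤ 1)) (Real.exp_pos _).le)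
  rw [← Real.exp_add] at hup2 hlo2
  have e1 : -(δ / 2) * ((1 + δ) * (N * p)) + (N * p * (δ / 2 + (δ / 2) ^ 2) + 1)
    = 1 - N * p * (δ ^ 2 / 4) := by ring
  have e2 : -(-(δ / 2)) * ((1 - δ) * (N * p)) + (N * p * (-(δ / 2) + (-(δ / 2)) ^ 2) + 1)
    = 1 - N * p * (δ ^ 2 / 4) := by ring
  rw [e1] at hup2
  rw [e2] at hlo2
  have hsub : {G | δ * (N * p) < |degreeSum i G - N * p|} ⊆
      {G | (1 + δ) * (N * p) ≤ degreeSum i G} ∪ {G | degreeSum i G ≤ (1 - δ) * (N * p)} := by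
    intro G hG
    rcases lt_abs.1 (show δ * (N * p) < |degreeSum i G - N * p| from hG) with h | h
    · exact Or.inl (by simp only [Set.mem_ofPred_eq]; linarith)
    · exact Or.inr (by simp only [Set.mem_ofPred_eq]; linarith)
  refine (measureReal_mono hsub).trans ((measureReal_union_le _ _).trans ?_)
  linarith

/-- With high probability all degrees of `G(N, p(N))` are close to `N p(N)`. -/
lemma tendsto_binomialRandom_degreeSum (p : ℕ → I)
    (hp : (fun N : ℕ => Real.log (N : ℝ) / (N : ℝ)) =o[atTop] (fun N : ℕ => (p N : ℝ)))
    {δ : ℝ} (h0 : 0 < δ) (h1 : δ ≤ 1) :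
    Tendsto (fun N : ℕ => binomialRandom (Fin N) (p N)
      {G | ∀ i, |degreeSum i G - N * p N| ≤ δ * (N * p N)}) atTop (𝓝 1) := by
  have hbound : ∀ᶠ N : ℕ in atTop, 1 - ENNReal.ofReal (2 * Real.exp 1 * (1 / N)) ≤
      binomialRandom (Fin N) (p N) {G | ∀ i, |degreeSum i G - N * p N| ≤ δ * (N * p N)} := by
    -- The constant `δ² / 8` makes the Chernoff exponent at least `2 log N`, so a union over `N`
    -- vertices leaves `O(1 / N)`.
    filter_upwards [hp.bound (by positivity : 0 < δ ^ 2 / 8), eventually_gt_atTop 0] with N hN hpos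
    have hN0 : (0 : ℝ) < N := by exact_mod_cast hpos
    set μ := binomialRandom (Fin N) (p N)
    have hlog : 2 * Real.log N ≤ N * p N * (δ ^ 2 / 4) := by
      have h2 := (le_abs_self _).trans hN
      rw [Real.norm_eq_abs, abs_of_nonneg (p N).2.1, div_le_iff₀ hN0] at h2
      linarith
    have hc : {G | ∀ i, |degreeSum i G - N * p N| ≤ δ * (N * p N)}ᶜ =
        ⋃ i : Fin N, {G | δ * (N * p N) < |degreeSum i G - N * p N|} := by
      ext G; simp
    have hcompl : μ {G | ∀ i, |degreeSum i G - N * p N| ≤ δ * (N * p N)}ᶜ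
        ≤ ENNReal.ofReal (2 * Real.exp 1 * (1 / N)) := by
      rw [← ENNReal.ofReal_toReal (measure_ne_top μ _)]
      refine ENNReal.ofReal_le_ofReal ?_
      rw [← measureReal_def, hc]
      refine (measureReal_iUnion_fintype_le _).trans ((Finset.sum_le_sum fun i _ =>
        measureReal_degreeSum_le i (p N) h0 h1).trans ?_)
      rw [Finset.sum_const, Finset.card_univ, Fintype.card_fin, nsmul_eq_mul]
      have h3 : Real.exp (1 - N * p N * (δ ^ 2 / 4)) ≤ Real.exp 1 * (1 / N * (1 / N)) := by
        calc _ ≤ Real.exp (1 + (-Real.log N + -Real.log N)) :=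
              Real.exp_le_exp.2 (by linarith)
          _ = _ := by
              rw [Real.exp_add, Real.exp_add, Real.exp_neg, Real.exp_log hN0, one_div]
      calc _ ≤ N * (2 * (Real.exp 1 * (1 / N * (1 / N)))) := by gcongr
        _ = _ := by field_simp
    rw [tsub_le_iff_right]
    calc (1 : ENNReal) = μ Set.univ := measure_univ.symm
      _ ≤ _ := (measure_univ_le_add_compl _).trans (add_le_add_right hcompl _)
  have hlim : Tendsto (fun N : ℕ => 1 - ENNReal.ofReal (2 * Real.exp 1 * (1 / N))) atTop (𝓝 1) := by
    have : Tendsto (fun N : ℕ => ENNReal.ofReal (2 * Real.exp 1 * (1 / N))) atTop (𝓝 0) := by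
      have h := (tendsto_one_div_atTop_nhds_zero_nat (𝕜 := ℝ)).const_mul (2 * Real.exp 1)
      rw [mul_zero] at h
      simpa using ENNReal.tendsto_ofReal h
    simpa using ENNReal.Tendsto.sub tendsto_const_nhds this (Or.inl ENNReal.one_ne_top)
  exact tendsto_of_tendsto_of_tendsto_of_le_of_le' hlim tendsto_const_nhds hbound
    (Eventually.of_forall fun N => prob_le_one)

end SimpleGraph
end

/-! ### Nearly regular graphs and the two temperature regimes. -/

noncomputable section

namespace Ising

open Real SimpleGraph

variable {N : ℕ}

/-- All degrees are within a factor `1 ± δ` of `N p`. -/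
def NearlyRegular (p δ : ℝ) (G : SimpleGraph (Fin N)) : Prop :=
  ∀ i, |degreeSum i G - N * p| ≤ δ * (N * p)

lemma graphInteraction_apply (G : SimpleGraph (Fin N)) (p : ℝ) (i j : Fin N)
    [Decidable (G.Adj i j)] :
    graphInteraction G p i j = 1 / (N * p) * if G.Adj i j then 1 else 0 := by
  simp [graphInteraction, SimpleGraph.adjMatrix_apply]

lemma sum_graphInteraction (G : SimpleGraph (Fin N)) (p : ℝ) (i : Fin N) :
    ∑ j, graphInteraction G p i j = 1 / (N * p) * degreeSum i G := by
  classical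
  simp only [graphInteraction_apply, ← Finset.mul_sum, degreeSum]

/-- Every entry is `0` or `1 / (N p)`. On nearly regular graphs this puts the squared Frobenius norm
at order `1 / p`. -/
lemma frobSq_graphInteraction (G : SimpleGraph (Fin N)) (p : ℝ) :
    frobSq (graphInteraction G p) = 1 / (N * p) * ∑ i, ∑ j, graphInteraction G p i j := by
  classical
  simp only [frobSq, Finset.mul_sum]
  refine Finset.sum_congr rfl fun i _ => Finset.sum_congr rfl fun j _ => ?_
  rw [graphInteraction_apply]
  split_ifs <;> ring

section
variable {p δ : ℝ} {G : SimpleGraph (Fin N)}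

lemma sum_graphInteraction_mem (hNp : 0 < N * p) (hG : NearlyRegular p δ G) (i : Fin N) :
    1 - δ ≤ ∑ j, graphInteraction G p i j ∧ ∑ j, graphInteraction G p i j ≤ 1 + δ := by
  obtain ⟨h1, h2⟩ := abs_le.1 (hG i)
  rw [sum_graphInteraction, one_div_mul_eq_div, le_div_iff₀ hNp, div_le_iff₀ hNp]
  constructor <;> linarith

lemma isFerromagnetic_graphInteraction (hNp : 0 < N * p) (hG : NearlyRegular p δ G) :
    IsFerromagnetic (graphInteraction G p) (1 + δ) := by
  classical
  refine ⟨fun i j => ?_, fun i => ?_, fun i j => ?_, fun i =>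
    (sum_graphInteraction_mem hNp hG i).2⟩
  · rw [graphInteraction_apply, graphInteraction_apply]; simp only [G.adj_comm]
  · simp [graphInteraction_apply]
  · rw [graphInteraction_apply]; positivity

lemma le_sum_sum_graphInteraction (hNp : 0 < N * p) (hG : NearlyRegular p δ G) :
    (1 - δ) * N ≤ ∑ i, ∑ j, graphInteraction G p i j := by
  calc (1 - δ) * N = ∑ i : Fin N, (1 - δ) := by
        rw [Finset.sum_const, Finset.card_univ, Fintype.card_fin, nsmul_eq_mul, mul_comm]
    _ ≤ _ := Finset.sum_le_sum fun i _ => (sum_graphInteraction_mem hNp hG i).1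

lemma sum_sum_graphInteraction_le (hNp : 0 < N * p) (hG : NearlyRegular p δ G) :
    ∑ i, ∑ j, graphInteraction G p i j ≤ (1 + δ) * N := by
  calc _ ≤ ∑ i : Fin N, (1 + δ) :=
        Finset.sum_le_sum fun i _ => (sum_graphInteraction_mem hNp hG i).2
    _ = (1 + δ) * N := by
        rw [Finset.sum_const, Finset.card_univ, Fintype.card_fin, nsmul_eq_mul, mul_comm]

lemma le_frobSq_graphInteraction (hN : 0 < N) (hp : 0 < p) (hG : NearlyRegular p δ G) :
    (1 - δ) * (1 / p) ≤ frobSq (graphInteraction G p) := by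
  have hN' : (0 : ℝ) < N := by exact_mod_cast hN
  rw [frobSq_graphInteraction]
  calc _ = 1 / (N * p) * ((1 - δ) * N) := by field_simp
    _ ≤ _ := mul_le_mul_of_nonneg_left (le_sum_sum_graphInteraction (by positivity) hG)
        (by positivity)

lemma frobSq_graphInteraction_le (hN : 0 < N) (hp : 0 < p) (hG : NearlyRegular p δ G) :
    frobSq (graphInteraction G p) ≤ (1 + δ) * (1 / p) := by
  have hN' : (0 : ℝ) < N := by exact_mod_cast hN
  rw [frobSq_graphInteraction]
  calc _ ≤ 1 / (N * p) * ((1 + δ) * N) :=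
        mul_le_mul_of_nonneg_left (sum_sum_graphInteraction_le (by positivity) hG)
        (by positivity)
    _ = _ := by field_simp

end

/-- The edge probability may be `0` for some `N`, but where the bound `log N / N ≤ p(N)` holds with
`N > 1` it cannot be. -/
lemma eventually_pos_of_isLittleO {p : ℕ → unitInterval}
    (hp : (fun N : ℕ => Real.log (N : ℝ) / (N : ℝ)) =o[atTop] (fun N : ℕ => (p N : ℝ))) :
    ∀ᶠ N : ℕ in atTop, 0 < N ∧ 0 < (p N : ℝ) := by
  filter_upwards [hp.bound one_pos, eventually_gt_atTop 1] with N hN h1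
  have hN1 : (1 : ℝ) < N := by exact_mod_cast h1
  refine ⟨by omega, (p N).2.1.lt_of_ne fun h => ?_⟩
  rw [← h] at hN
  simp only [norm_zero, mul_zero, norm_le_zero_iff] at hN
  exact absurd hN (div_pos (log_pos hN1) (by linarith)).ne'

/-- Consistency follows from a uniform bound on nearly regular graphs. -/
lemma isConsistentErdosRenyi_of_nearlyRegular {p : ℕ → unitInterval} {β : ℝ} {a : ℕ → ℝ} {δ : ℝ}
    (hp : (fun N : ℕ => Real.log (N : ℝ) / (N : ℝ)) =o[atTop] (fun N : ℕ => (p N : ℝ)))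
    (h0 : 0 < δ) (h1 : δ ≤ 1)
    (h : ∀ ε : ℝ, 0 < ε → ∃ (K : ℝ) (N₀ : ℕ), ∀ N ≥ N₀, 0 < N → 0 < (p N : ℝ) →
      ∀ G : SimpleGraph (Fin N), NearlyRegular (p N : ℝ) δ G →
        deviationProb (graphInteraction G (p N : ℝ)) β (a N) K ≤ ε) :
    IsConsistentErdosRenyi p β a := fun ε hε => by
  obtain ⟨K, N₀, hK⟩ := h ε hε
  refine ⟨K, tendsto_of_tendsto_of_tendsto_of_le_of_le'
    (tendsto_binomialRandom_degreeSum p hp h0 h1) tendsto_const_nhds ?_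
    (Eventually.of_forall fun N => prob_le_one)⟩
  filter_upwards [eventually_pos_of_isLittleO hp, eventually_ge_atTop N₀] with N hN hN₀
  exact measure_mono fun G hG => hK N hN₀ hN.1 hN.2 G hG

/-- High temperature. -/
lemma isConsistentErdosRenyi_of_lt_one {p : ℕ → unitInterval} {β : ℝ} (hβ : 0 < β) (hβ1 : β < 1)
    (hp : (fun N : ℕ => Real.log (N : ℝ) / (N : ℝ)) =o[atTop] (fun N : ℕ => (p N : ℝ))) :
    IsConsistentErdosRenyi p β (fun N : ℕ => √(1 / (p N : ℝ))) := by
  -- This slack keeps `β (1 + δ) < 1`, because `(1 - β)(2 - β) > 0`.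
  set δ := (1 - β) / 2 with hδ
  have hδ0 : 0 < δ := by rw [hδ]; linarith
  have hδ1 : δ ≤ 1 / 2 := by rw [hδ]; linarith
  set R := 1 + δ with hR
  have hR0 : 0 < R := by linarith
  have hβR : β * R < 1 := by rw [hR, hδ]; nlinarith
  refine isConsistentErdosRenyi_of_nearlyRegular hp hδ0 (by linarith) fun ε hε => ?_
  set C := (4 + 4 * β * R) * (R / (1 - β * R)) + 4 * β * R * R with hC
  have h1R : 0 < 1 - β * R := by linarith
  have hC0 : 0 < C := by positivity
  set c₁ := β ^ 2 / (8 * cosh (β * R) ^ 2 * (1 + β * R + β ^ 2 * R ^ 2)) with hc₁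
  have hc₁0 : 0 < c₁ := by have := cosh_pos (β * R); positivity
  obtain ⟨K, A₀, hA₀, hK⟩ := exists_prob_mple_le hβ hC0
    (mul_pos hc₁0 (by linarith : 0 < 1 - δ)) hε R
  obtain ⟨L, N₀, hL, hdense⟩ := exists_prob_mple_le_of_frobSq_le hβ hR0.le hβR
    (mul_pos hR0 hA₀) hε
  refine ⟨max K (√A₀ * L), N₀, fun N hN hN0 hp0 G hG => ?_⟩
  have hNp : 0 < (N : ℝ) * p N := by positivity
  have hJ := isFerromagnetic_graphInteraction hNp hG
  have hfu := frobSq_graphInteraction_le hN0 hp0 hG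
  have hfl := le_frobSq_graphInteraction hN0 hp0 hG
  have hA : 0 < 1 / (p N : ℝ) := by positivity
  -- The split is made for each `N` separately, so `p` may alternate between sparse and dense. In
  -- the dense case `√(1 / p) ≤ √A₀`, and tightness suffices.
  rcases le_total A₀ (1 / (p N : ℝ)) with hle | hle
  · have hsA := sqrt_pos.2 hA
    refine (deviationProb_le (sqrt_nonneg _) (L := K / √(1 / (p N : ℝ))) ?_).trans
      (hK N _ (1 / (p N : ℝ)) hJ hR0.le hle ?_ ?_)
    · rw [mul_div_cancel₀ _ hsA.ne']; exact le_max_left _ _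
    · refine (expect_score_sq_le hJ hβ.le).trans ?_
      have h1 : expect (graphInteraction G (p N : ℝ)) β (fieldSq (graphInteraction G (p N : ℝ)))
          ≤ R / (1 - β * R) * (1 / (p N : ℝ)) := by
        rw [div_mul_eq_mul_div, le_div_iff₀' h1R]
        exact (expect_fieldSq_le hJ hβ.le).trans hfu
      calc _ ≤ (4 + 4 * β * R) * (R / (1 - β * R) * (1 / (p N : ℝ)))
            + 4 * β * R * (R * (1 / (p N : ℝ))) := by gcongr
        _ = _ := by rw [hC]; ring
    · refine le_trans ?_ (le_logPartition hJ hβ)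
      rw [mul_assoc]
      exact mul_le_mul_of_nonneg_left hfl hc₁0.le
  · refine (deviationProb_le (sqrt_nonneg _) (L := L) ?_).trans
      (hdense N hN _ hJ (hfu.trans (mul_le_mul_of_nonneg_left hle hR0.le)) fun j => ?_)
    · exact (mul_le_mul_of_nonneg_right (sqrt_le_sqrt hle) hL.le).trans (le_max_right _ _)
    · simp only [hJ.symm _ j]
      linarith [(sum_graphInteraction_mem hNp hG j).1]

/-- Low temperature. -/
lemma isConsistentErdosRenyi_of_one_lt {p : ℕ → unitInterval} {β : ℝ} (hβ1 : 1 < β)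
    (hp : (fun N : ℕ => Real.log (N : ℝ) / (N : ℝ)) =o[atTop] (fun N : ℕ => (p N : ℝ))) :
    IsConsistentErdosRenyi p β (fun N : ℕ => √(N : ℝ)) := by
  have hβ : 0 < β := by linarith
  -- With this slack `β (1 - δ) = (β + 1) / 2 > 1`, so the effective inverse temperature stays
  -- supercritical.
  set δ := (β - 1) / (2 * β) with hδ
  have hδ0 : 0 < δ := div_pos (by linarith) (by linarith)
  have hδ1 : δ ≤ 1 / 2 := by rw [hδ, div_le_div_iff₀ (by linarith) two_pos]; linarith
  have hβδ : 1 < β * (1 - δ) := by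
    have : β * (1 - δ) = (β + 1) / 2 := by rw [hδ]; field_simp; ring
    rw [this]; linarith
  obtain ⟨h, hpos⟩ := exists_tilt_pos hβδ
  set c := β * (1 - δ) / 2 * tanh h ^ 2 - h * tanh h + log (cosh h) with hc
  set R := 1 + δ with hR
  have hR0 : 0 < R := by linarith
  refine isConsistentErdosRenyi_of_nearlyRegular hp hδ0 (by linarith) fun ε hε => ?_
  set C := (4 + 4 * β * R) * R ^ 2 + 4 * β * R * R ^ 2 with hC
  have hC0 : 0 < C := by positivity
  obtain ⟨K, A₀, hA₀, hK⟩ := exists_prob_mple_le hβ hC0 hpos hε R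
  refine ⟨K, ⌈A₀⌉₊, fun N hN hN0 hp0 G hG => ?_⟩
  have hNp : 0 < (N : ℝ) * p N := by positivity
  have hJ := isFerromagnetic_graphInteraction hNp hG
  have hA : 0 < (N : ℝ) := by exact_mod_cast hN0
  have hsA := sqrt_pos.2 hA
  refine (deviationProb_le (sqrt_nonneg _) (L := K / √(N : ℝ)) ?_).trans
      (hK N _ N hJ hR0.le (Nat.ceil_le.1 hN) ?_ ?_)
  · rw [mul_div_cancel₀ _ hsA.ne']
  · refine (expect_score_sq_le hJ hβ.le).trans ?_
    have h1 := expect_fieldSq_le_card hJ β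
    have h2 : frobSq (graphInteraction G (p N : ℝ)) ≤ N * R ^ 2 := by
      calc _ ≤ ∑ i : Fin N, R ^ 2 := Finset.sum_le_sum fun i _ => by
            simp only [hJ.symm i]; exact sum_sq_le hJ i
        _ = _ := by simp
    calc _ ≤ (4 + 4 * β * R) * (N * R ^ 2) + 4 * β * R * (N * R ^ 2) := by gcongr
      _ = _ := by rw [hC]; ring
  · refine le_trans ?_ (tilt_le_logPartition hJ β h)
    have := mul_le_mul_of_nonneg_left (le_sum_sum_graphInteraction hNp hG)
      (by positivity : 0 ≤ β / 2 * tanh h ^ 2)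
    rw [hc]
    linarith

end Ising

end

theorem corollary4 (β₀ : ℝ) (hβ₀ : 0 < β₀) (p : ℕ → unitInterval)
    (hp : (fun N : ℕ => Real.log (N : ℝ) / (N : ℝ)) =o[atTop] (fun N : ℕ => (p N : ℝ))) :
    (β₀ < 1 → Ising.IsConsistentErdosRenyi p β₀ (fun N : ℕ => √(1 / (p N : ℝ)))) ∧
    (1 < β₀ → Ising.IsConsistentErdosRenyi p β₀ (fun N : ℕ => √(N : ℝ))) :=
  ⟨fun h => Ising.isConsistentErdosRenyi_of_lt_one hβ₀ h hp,
    fun h => Ising.isConsistentErdosRenyi_of_one_lt h hp⟩
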